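/- Let $p$ be a prime, $m\ge 1$, $r=p^m$, and suppose $3\mid\frac{r-1}{p-1}$ and $r-1=3n$ with $n>1$. Let $\alpha$ be a primitive element of $\mathbb{F}_r$, let $I\subset\{0,1,2\}$ with $\#I=1$, say $I=\{i\}$, and let $D=C_i^{(3,r)}=\alpha^i\langle\alpha^3\rangle$. Let $$C_D=\{(\mathrm{Tr}(xd))_{d\in D}: x\in\mathbb{F}_r\},$$ where $\mathrm{Tr}$ is the trace from $\mathbb{F}_r$ to $\mathbb{F}_p$. For a code $C\subseteq\mathbb{F}_p^n$ let $\mathrm{CWE}(C)=\sum_{\mathsf c\in C}\prod_{\rho\in\mathbb{F}_p}w_\rho^{k_\rho(\mathsf c)}$, where $k_\rho(\mathsf c)$ is the number of components of $\mathsf c$ equal to $\rho$ and the $w_\rho$ are indeterminates. Then $C_D$ is an $[n,m]$ cyclic code over $\mathbb{F}_p$ (length $n$, dimension $m$; cyclic with the coordinates ordered as $\alpha^i,\alpha^{i+3},\dots,\alpha^{i+3(n-1)}$), and its complete weight enumerator is as follows, all exponents being nonnegative integers. (a) If $p\equiv1\pmod 3$ and $m\equiv0\pmod 3$, then there are integers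 $s_1,t_1$ with $4r^{1/3}=s_1^2+27t_1^2$, $s_1\equiv1\pmod3$ and $\gcd(s_1,p)=1$, and for all such $s_1,t_1$ $$\begin{aligned}\mathrm{CWE}(C_D)=w_0^n&+n\,w_0^{\frac np-\frac{p-1}{3p}(1-s_1r^{1/3})}\prod_{\rho=1}^{p-1}w_\rho^{\frac np+\frac1{3p}(1-s_1r^{1/3})}\\&+n\,w_0^{\frac np-\frac{p-1}{6p}(2+(s_1+9t_1)r^{1/3})}\prod_{\rho=1}^{p-1}w_\rho^{\frac np+\frac1{6p}(2+(s_1+9t_1)r^{1/3})}\\&+n\,w_0^{\frac np-\frac{p-1}{6p}(2+(s_1-9t_1)r^{1/3})}\prod_{\rho=1}^{p-1}w_\rho^{\frac np+\frac1{6p}(2+(s_1-9t_1)r^{1/3})}.\end{aligned}$$ (b) If $p\equiv2\pmod3$ and $m\equiv0\pmod4$, then $$\mathrm{CWE}(C_D)=w_0^n+2n\,w_0^{\frac np-\frac{p-1}{3p}(1-\sqrt r)}\prod_{\rho=1}^{p-1}w_\rho^{\frac np+\frac1{3p}(1-\sqrt r)}+n\,w_0^{\frac np-\frac{p-1}{3p}(1+2\sqrt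 r)}\prod_{\rho=1}^{p-1}w_\rho^{\frac np+\frac1{3p}(1+2\sqrt r)}.$$ (c) If $p\equiv2\pmod3$ and $m\equiv2\pmod4$, then $$\mathrm{CWE}(C_D)=w_0^n+2n\,w_0^{\frac np-\frac{p-1}{3p}(1+\sqrt r)}\prod_{\rho=1}^{p-1}w_\rho^{\frac np+\frac1{3p}(1+\sqrt r)}+n\,w_0^{\frac np-\frac{p-1}{3p}(1-2\sqrt r)}\prod_{\rho=1}^{p-1}w_\rho^{\frac np+\frac1{3p}(1-2\sqrt r)}.$$ -/

import Mathlib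

open scoped Classical in
/-- The cyclotomic class `C_i^{(N,r)} = α^i ⟨α^N⟩` of order `N` in the finite field `F`. -/
noncomputable def cyclotomicClass {F : Type*} [Field F] [Fintype F] (α : Fˣ) (N i : ℕ) :
    Finset F :=
  Finset.univ.filter fun x => ∃ u ∈ Subgroup.zpowers (α ^ N), x = ((α ^ i * u : Fˣ) : F)

open scoped Classical in
/-- The defining set `D = ⋃_{i ∈ I} C_i^{(N,r)}`. -/
noncomputable def definingSet {F : Type*} [Field F] [Fintype F] (α : Fˣ) (N : ℕ)
    (I : Finset ℕ) : Finset F :=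
  I.biUnion fun i => cyclotomicClass α N i

/-- The linear code `C_D = {(Tr(x d))_{d ∈ D} : x ∈ F}` over `𝔽_p` with defining set `D`;
the coordinates are indexed by the elements of `D`. -/
noncomputable def traceCode (p : ℕ) [Fact p.Prime] {F : Type*} [Field F] [Algebra (ZMod p) F]
    (D : Finset F) : Submodule (ZMod p) (D → ZMod p) :=
  LinearMap.range (LinearMap.pi fun d : D =>
    (Algebra.trace (ZMod p) F) ∘ₗ (LinearMap.mulRight (ZMod p) (d : F)))

/-- The complete weight enumerator `w[c] = ∏_ρ w_ρ ^ k_ρ` of a word `c`, where `k_ρ` is the number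
of components of `c` equal to `ρ`; the indeterminate `w_ρ` is `MvPolynomial.X ρ`. -/
noncomputable def wordCWE {p : ℕ} [Fact p.Prime] {ι : Type*} [Fintype ι] (c : ι → ZMod p) :
    MvPolynomial (ZMod p) ℤ :=
  ∏ ρ : ZMod p, MvPolynomial.X ρ ^ (Finset.univ.filter fun j => c j = ρ).card

open scoped Classical in
/-- The complete weight enumerator of a code: the sum of `w[c]` over all codewords `c`. -/
noncomputable def codeCWE {p : ℕ} [Fact p.Prime] {ι : Type*} [Fintype ι]
    (C : Submodule (ZMod p) (ι → ZMod p)) : MvPolynomial (ZMod p) ℤ :=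
  ∑ c : ι → ZMod p with c ∈ C, wordCWE c

/-- A linear code of length `n` is cyclic if `(c_0, …, c_{n-1}) ∈ C` implies
`(c_{n-1}, c_0, …, c_{n-2}) ∈ C`. -/
def IsCyclicCode {p n : ℕ} (C : Submodule (ZMod p) (Fin n → ZMod p)) : Prop :=
  ∀ c ∈ C, c ∘ (finRotate n).symm ∈ C

/-- The monomial `w_0 ^ a * ∏_{ρ ≠ 0} w_ρ ^ b`. -/
noncomputable def balancedMonomial (p : ℕ) [Fact p.Prime] (a b : ℕ) : MvPolynomial (ZMod p) ℤ :=
  MvPolynomial.X 0 ^ a * ∏ ρ ∈ Finset.univ.erase (0 : ZMod p), MvPolynomial.X ρ ^ b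

/-- The conditions `4 r^{1/3} = s² + 27 t²`, `s ≡ 1 (mod 3)`, `gcd(s, p) = 1` on integers
`s, t`. -/
def IsCubicPair (p r : ℕ) (s t : ℤ) : Prop :=
  4 * (r : ℝ) ^ (1 / 3 : ℝ) = (s : ℝ) ^ 2 + 27 * (t : ℝ) ^ 2 ∧
    s ≡ 1 [ZMOD 3] ∧ IsCoprime s (p : ℤ)

/-! The word of `x` is controlled by one integer, the cubic sum `S(a) = ∑_y ζ^{Tr(a y³)}` at `a = x
α^i`. Since `3 ∣ (r-1)/(p-1)`, every nonzero scalar is a cube in `F`, so all nonzero trace values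
occur equally often and `S(a)` is an integer that determines the weights (`exists_counts`). It
depends only on the coset of `a` modulo cubes, so for `a ≠ 0` it takes just three values, each on
`n` elements, and `CWE` is a symmetric function of them (`codeCWE_eq`).

Orthogonality of characters turns the power sums of these values into point counts on diagonal
cubics. The values sum to `0`, their squares sum to `6r`, and their product is `rT`, where `T = A +
1 - 3n` and `A` is the number of affine points of `X³ + Y³ = 1`.

If `p ≡ 1 (mod 3)`, power sums over `F` give `T ≡ -C(2n, n) (mod p)`, which is nonzero by Lucas
(`cubicSum_product`). With `r = p^{3k}` this forces each value to be exactly divisible by `p^k`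
(`eq_pow_mul_of_sum_zero`). The cofactors are `1 (mod 3)`, and congruences modulo 9 put them in the
form `s, (-s ∓ 9t)/2` with `4p^k = s² + 27t²`. Such a pair is unique up to the sign of `t`
(`cubic_pair_unique`).

If `p ≡ 2 (mod 3)`, the first two moments suffice: `p` is inert for the form `x² + xy + y²`, so
descent reduces to `r = 1` (`perm_of_sum_zero_of_inert`), and the residue modulo 3 fixes the sign.
-/

theorem mem_zpowers_cube_iff {G : Type*} [Group G] {α : G}
    (hα : ∀ x : G, x ∈ Subgroup.zpowers α) (u : G) :
    u ∈ Subgroup.zpowers (α ^ 3) ↔ ∃ y : G, y ^ 3 = u := by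
  constructor
  · rintro ⟨k, rfl⟩
    exact ⟨α ^ k, by simp only [← zpow_natCast, ← zpow_mul, mul_comm]⟩
  · rintro ⟨y, rfl⟩
    obtain ⟨k, rfl⟩ := hα y
    exact ⟨k, by simp only [← zpow_natCast, ← zpow_mul, mul_comm]⟩

/-! ### Cubic residues, power sums, and the Fermat cubic modulo `p` -/

section CubicResidues

variable {F : Type*} [Field F] [Fintype F]

theorem orderOf_generator {n : ℕ} (hF : Fintype.card F = n * 3 + 1) {α : Fˣ}
    (hα : ∀ x : Fˣ, x ∈ Subgroup.zpowers α) : orderOf α = n * 3 := by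
  classical
  rw [orderOf_eq_card_of_forall_mem_zpowers hα, Nat.card_eq_fintype_card, Fintype.card_units, hF]
  rfl

theorem pow_card_third_eq_one_iff {n : ℕ} (hn : 0 < n) (hF : Fintype.card F = n * 3 + 1) {α : Fˣ}
    (hα : ∀ x : Fˣ, x ∈ Subgroup.zpowers α) (u : Fˣ) : u ^ n = 1 ↔ ∃ y : Fˣ, y ^ 3 = u := by
  have ho := orderOf_generator hF hα
  constructor
  · intro h
    obtain ⟨k, rfl⟩ := mem_powers_iff_mem_zpowers.2 (hα u)
    simp only at h ⊢
    rw [← pow_mul, ← orderOf_dvd_iff_pow_eq_one, ho, mul_comm k] at h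
    obtain ⟨j, rfl⟩ := Nat.dvd_of_mul_dvd_mul_left hn h
    exact ⟨α ^ j, by rw [← pow_mul, mul_comm]⟩
  · rintro ⟨y, rfl⟩
    obtain ⟨k, rfl⟩ := mem_powers_iff_mem_zpowers.2 (hα y)
    simp only
    rw [← pow_mul, ← pow_mul, ← orderOf_dvd_iff_pow_eq_one, ho]
    exact ⟨k, by ring⟩

/-- If a finite field contains a primitive cube root of unity, every nonzero cube has exactly
three cube roots. -/
theorem card_cube_fiber [DecidableEq F] {n : ℕ} (hn : 0 < n) (hF : Fintype.card F = n * 3 + 1)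
    {α : Fˣ} (hα : ∀ x : Fˣ, x ∈ Subgroup.zpowers α) {u : F} (hu : u ≠ 0) :
    (Finset.univ.filter fun y : F => y ^ 3 = u).card = if u ^ n = 1 then 3 else 0 := by
  have ho := orderOf_generator hF hα
  have hiff := pow_card_third_eq_one_iff hn hF hα (Units.mk0 u hu)
  have hu1 : u ^ n = 1 ↔ (Units.mk0 u hu) ^ n = 1 := by
    rw [← Units.val_inj]; simp
  split_ifs with h
  · obtain ⟨y, hy⟩ := hiff.1 (hu1.1 h)
    have hy' : (y : F) ^ 3 = u := by rw [← Units.val_pow_eq_pow_val, hy]; simp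
    have hprim : IsPrimitiveRoot (α ^ n) 3 := by
      have := IsPrimitiveRoot.orderOf α
      rw [ho] at this
      exact this.pow (by omega) rfl
    have hprim' : IsPrimitiveRoot ((α ^ n : Fˣ) : F) 3 := IsPrimitiveRoot.coe_units_iff.2 hprim
    have h1 : (Finset.univ.filter fun y : F => y ^ 3 = u) = (Polynomial.nthRoots 3 u).toFinset := by
      ext z; simp [Polynomial.mem_nthRoots]
    rw [h1, Multiset.toFinset_card_of_nodup (hprim'.nthRoots_nodup hu), hprim'.card_nthRoots,
      if_pos ⟨y, hy'⟩]
  · rw [Finset.card_eq_zero, Finset.filter_eq_empty_iff]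
    intro y _ hy
    apply h
    have hy0 : y ≠ 0 := by rintro rfl; apply hu; rw [← hy]; simp
    rw [hu1, hiff]
    exact ⟨Units.mk0 y hy0, by ext; simpa using hy⟩

/-- For `u ≠ 0`, `u^n` is a cube root of unity `ω`, and `1 + ω + ω²` is `3` or `0` according to
Euler's criterion. The count thus becomes a polynomial in `u`, ready for power sums. -/
theorem card_cube_fiber_cast [DecidableEq F] {n : ℕ} (hn : 0 < n)
    (hF : Fintype.card F = n * 3 + 1) {α : Fˣ} (hα : ∀ x : Fˣ, x ∈ Subgroup.zpowers α) (u : F) :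
    ((Finset.univ.filter fun y : F => y ^ 3 = u).card : F) = 1 + u ^ n + u ^ (2 * n) := by
  by_cases hu : u = 0
  · subst hu
    have : (Finset.univ.filter fun y : F => y ^ 3 = 0) = {0} := by
      ext z; simp
    rw [this]
    simp [hn.ne']
  · rw [card_cube_fiber hn hF hα hu]
    split_ifs with h
    · rw [mul_comm, pow_mul, h]; norm_num
    · have h3 : (u ^ n) ^ 3 = 1 := by
        rw [← pow_mul, ← FiniteField.pow_card_sub_one_eq_one u hu, hF]; rfl
      have h4 : (u ^ n - 1) * (1 + u ^ n + u ^ (2 * n)) = 0 := by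
        rw [mul_comm 2 n, pow_mul]; linear_combination h3
      rw [Nat.cast_zero, (mul_eq_zero.1 h4).resolve_left (sub_ne_zero.2 h)]

/-- Below the bound, the only positive multiple of `q - 1` is `q - 1` itself. The exponent `0` gives
`q = 0`, because `0 ^ 0 = 1`. -/
theorem sum_pow_eq [DecidableEq F] {k : ℕ} (hk : k < 2 * (Fintype.card F - 1)) :
    ∑ u : F, u ^ k = if k = Fintype.card F - 1 then -1 else 0 := by
  rcases lt_or_ge k (Fintype.card F - 1) with h | h
  · rw [FiniteField.sum_pow_lt_card_sub_one F k h, if_neg h.ne]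
  · have hc : 1 < Fintype.card F := Fintype.one_lt_card
    have hk0 : k ≠ 0 := by omega
    have h1 : ∑ u : F, u ^ k = ∑ u : Fˣ, (u : F) ^ k := by
      rw [← Finset.sum_filter_add_sum_filter_not Finset.univ (fun u : F => u ≠ 0)]
      have : ∑ u ∈ Finset.univ.filter (fun u : F => ¬ u ≠ 0), u ^ k = 0 :=
        Finset.sum_eq_zero fun u hu => by
          have : u = 0 := by simpa using hu
          rw [this, zero_pow hk0]
      rw [this, add_zero]
      symm
      refine Finset.sum_bij (fun u _ => (u : F)) (by simp) (fun a _ b _ h => Units.ext h) ?_ (by simp)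
      intro b hb
      exact ⟨Units.mk0 b (by simpa using hb), by simp, by simp⟩
    rw [h1, FiniteField.sum_pow_units]
    congr 1
    apply propext
    constructor
    · rintro ⟨c, hc'⟩
      have hc2 : c < 2 := by
        by_contra hcon
        have : (Fintype.card F - 1) * 2 ≤ (Fintype.card F - 1) * c :=
          Nat.mul_le_mul_left _ (by omega)
        omega
      have : c ≠ 0 := by rintro rfl; omega
      have : c = 1 := by omega
      rw [hc', this, mul_one]
    · intro h; rw [h]

theorem sum_pow_mul_one_sub_pow {i j : ℕ} (hi : i ≤ Fintype.card F - 1)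
    (hij : i + j < 2 * (Fintype.card F - 1)) :
    ∑ u : F, u ^ i * (1 - u) ^ j =
      -((-1) ^ (Fintype.card F - 1 - i) * (j.choose (Fintype.card F - 1 - i) : F)) := by
  classical
  set q := Fintype.card F - 1
  have h1 : ∀ u : F, u ^ i * (1 - u) ^ j =
      ∑ k ∈ Finset.range (j + 1), ((-1) ^ k * (j.choose k : F)) * u ^ (i + k) := by
    intro u
    rw [sub_eq_add_neg, add_comm 1 (-u), add_pow, Finset.mul_sum]
    refine Finset.sum_congr rfl fun k _ => ?_
    rw [one_pow, mul_one, neg_pow, pow_add]; ring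
  simp_rw [h1]
  rw [Finset.sum_comm]
  have h2 : ∀ k ∈ Finset.range (j + 1),
      ∑ u : F, ((-1) ^ k * (j.choose k : F)) * u ^ (i + k) =
        if k = q - i then -((-1) ^ k * (j.choose k : F)) else 0 := by
    intro k hk
    rw [Finset.mem_range] at hk
    rw [← Finset.mul_sum, sum_pow_eq (by omega)]
    have : i + k = Fintype.card F - 1 ↔ k = q - i := by omega
    simp only [this]
    split_ifs <;> ring
  rw [Finset.sum_congr rfl h2, Finset.sum_ite_eq']
  split_ifs with h
  · rfl
  · rw [Nat.choose_eq_zero_of_lt (by rw [Finset.mem_range] at h; omega)]; simp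

/-- The number of affine points of the Fermat cubic, modulo the characteristic. -/
theorem card_fermat_cubic_cast [DecidableEq F] {n : ℕ} (hn : 0 < n) (heven : Even n)
    (hF : Fintype.card F = n * 3 + 1) {α : Fˣ} (hα : ∀ x : Fˣ, x ∈ Subgroup.zpowers α) :
    ((Finset.univ.filter fun z : F × F => z.1 ^ 3 + z.2 ^ 3 = 1).card : F) =
      -(2 + ((2 * n).choose n : F)) := by
  -- Split the points according to `u = x³`, so that `1 - u = y³`.
  have h1 : (Finset.univ.filter fun z : F × F => z.1 ^ 3 + z.2 ^ 3 = 1).card =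
      ∑ u : F, (Finset.univ.filter fun y : F => y ^ 3 = u).card *
        (Finset.univ.filter fun y : F => y ^ 3 = 1 - u).card := by
    rw [Finset.card_eq_sum_card_fiberwise (f := fun z : F × F => z.1 ^ 3) (t := Finset.univ)
      (by intro x _; simp)]
    refine Finset.sum_congr rfl fun u _ => ?_
    rw [← Finset.card_product]
    congr 1
    ext ⟨x, y⟩
    simp only [Finset.mem_filter, Finset.mem_univ, true_and, Finset.mem_product]
    constructor
    · rintro ⟨h, rfl⟩; exact ⟨rfl, by rw [← h]; ring⟩
    · rintro ⟨rfl, h⟩; exact ⟨by rw [h]; ring, rfl⟩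
  have hq : Fintype.card F - 1 = 3 * n := by omega
  have key : ∀ i j : ℕ, i ≤ 2 → j ≤ 2 → ∑ u : F, u ^ (i * n) * (1 - u) ^ (j * n) =
      -((j * n).choose ((3 - i) * n) : F) := by
    intro i j hi hj
    have e1 : i * n ≤ 2 * n := Nat.mul_le_mul_right _ hi
    have e2 : j * n ≤ 2 * n := Nat.mul_le_mul_right _ hj
    rw [sum_pow_mul_one_sub_pow (by omega) (by omega), hq, ← Nat.sub_mul,
      (heven.mul_left (3 - i)).neg_one_pow, one_mul]
  have key0 : ∀ i j : ℕ, i ≤ 2 → j ≤ 2 → i + j < 3 →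
      ∑ u : F, u ^ (i * n) * (1 - u) ^ (j * n) = 0 := by
    intro i j hi hj hij
    rw [key i j hi hj, Nat.choose_eq_zero_of_lt]
    · simp
    · exact Nat.mul_lt_mul_of_pos_right (by omega) hn
  rw [h1]
  push_cast
  simp_rw [card_cube_fiber_cast hn hF hα]
  have h3 : ∀ u : F, (1 + u ^ n + u ^ (2 * n)) * (1 + (1 - u) ^ n + (1 - u) ^ (2 * n)) =
      u ^ (0 * n) * (1 - u) ^ (0 * n) + u ^ (0 * n) * (1 - u) ^ (1 * n) +
      u ^ (0 * n) * (1 - u) ^ (2 * n) + u ^ (1 * n) * (1 - u) ^ (0 * n) +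
      u ^ (1 * n) * (1 - u) ^ (1 * n) + u ^ (1 * n) * (1 - u) ^ (2 * n) +
      u ^ (2 * n) * (1 - u) ^ (0 * n) + u ^ (2 * n) * (1 - u) ^ (1 * n) +
      u ^ (2 * n) * (1 - u) ^ (2 * n) := by
    intro u
    simp only [zero_mul, pow_zero, one_mul]
    ring
  simp_rw [h3, Finset.sum_add_distrib]
  -- Only `i + j ≥ 3` survives: `(1,2)` and `(2,1)` give `-1` each, and `(2,2)` gives `-C(2n, n)`.
  rw [key0 0 0, key0 0 1, key0 0 2, key0 1 0, key0 1 1, key0 2 0, key 1 2, key 2 1, key 2 2] <;>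
    norm_num
  ring

/-- All `m` base-`p` digits of `n` equal `k = (p-1)/3`, and those of `2n` equal `2k < p`. Lucas
therefore gives `C(2k, k)^m`; the induction strips the last digit. -/
theorem not_dvd_centralBinom_third {p : ℕ} (hp : p.Prime) (hp3 : p ≡ 1 [MOD 3]) (m : ℕ) :
    ∀ n, p ^ m = n * 3 + 1 → ¬ p ∣ (2 * n).choose n := by
  have := Fact.mk hp
  obtain ⟨k, hk⟩ : ∃ k, p = 3 * k + 1 := ⟨p / 3, by unfold Nat.ModEq at hp3; omega⟩
  induction m with
  | zero =>
    intro n hn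
    have : n = 0 := by simpa using hn
    subst this
    simpa using hp.one_lt.ne'
  | succ m ih =>
    intro n hn
    obtain ⟨l, hl⟩ : ∃ l, p ^ m = l * 3 + 1 := by
      have h : p ^ m ≡ 1 [MOD 3] := by simpa using hp3.pow m
      exact ⟨p ^ m / 3, by unfold Nat.ModEq at h; omega⟩
    have hnl : n = k + p * l := by
      rw [pow_succ, hl] at hn
      have : n * 3 + 1 = 3 * (p * l) + p := by rw [← hn]; ring
      omega
    have h2n : 2 * n = 2 * k + p * (2 * l) := by rw [hnl]; ring
    have hp0 := hp.pos
    have hluc := Choose.choose_modEq_choose_mod_mul_choose_div_nat (p := p) (n := 2 * n) (k := n)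
    have e1 : 2 * n % p = 2 * k := by
      rw [h2n, Nat.add_mul_mod_self_left, Nat.mod_eq_of_lt (by omega)]
    have e2 : n % p = k := by
      rw [hnl, Nat.add_mul_mod_self_left, Nat.mod_eq_of_lt (by omega)]
    have e3 : 2 * n / p = 2 * l := by
      rw [h2n, Nat.add_mul_div_left _ _ hp0, Nat.div_eq_of_lt (by omega), zero_add]
    have e4 : n / p = l := by
      rw [hnl, Nat.add_mul_div_left _ _ hp0, Nat.div_eq_of_lt (by omega), zero_add]
    rw [e1, e2, e3, e4] at hluc
    rw [hluc.dvd_iff dvd_rfl, hp.dvd_mul, not_or]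
    refine ⟨fun h => ?_, ih l hl⟩
    have h5 : p ∣ (2 * k).factorial :=
      h.trans ⟨_, (Nat.choose_mul_factorial_mul_factorial (n := 2 * k) (k := k)
        (by omega)).symm.trans (mul_assoc _ _ _)⟩
    have := (hp.dvd_factorial).1 h5
    omega

end CubicResidues

/-! ### Cubic exponential sums and their moments as point counts -/

section TraceCounts

variable (p : ℕ) [Fact p.Prime]

/-- The canonical additive character of a finite field of characteristic `p`. -/
noncomputable def traceChar (F : Type*) [Field F] [Algebra (ZMod p) F] : AddChar F ℂ :=
  (ZMod.stdAddChar (N := p)).compAddMonoidHom (Algebra.trace (ZMod p) F).toAddMonoidHom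

theorem traceChar_apply {F : Type*} [Field F] [Algebra (ZMod p) F] (x : F) :
    traceChar p F x = ZMod.stdAddChar (Algebra.trace (ZMod p) F x) := rfl

/-- Every nonzero element of the prime field is a cube in `F`. -/
def ScalarsAreCubes (F : Type*) [Field F] [Algebra (ZMod p) F] : Prop :=
  ∀ c : ZMod p, c ≠ 0 → ∃ y : Fˣ, (y : F) ^ 3 = algebraMap (ZMod p) F c

variable {p} in
theorem neg_one_isCube {F : Type*} [Field F] [Algebra (ZMod p) F]
    (hcube : ScalarsAreCubes p F) : ∃ y : Fˣ, (y : F) ^ 3 = -1 := by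
  obtain ⟨y, hy⟩ := hcube (-1) (by simp)
  exact ⟨y, by simpa using hy⟩

variable {F : Type*} [Field F] [Fintype F] [Algebra (ZMod p) F]

/-- The number of `x` with `Tr (a x³) = ρ`. -/
noncomputable def cubeTraceCount (a : F) (ρ : ZMod p) : ℕ :=
  (Finset.univ.filter fun x : F => Algebra.trace (ZMod p) F (a * x ^ 3) = ρ).card

/-- The cubic exponential sum `∑ x, ζ ^ Tr (a x³)`, as an integer; see `sum_traceChar_cube`. -/
noncomputable def cubicSum (a : F) : ℤ := cubeTraceCount p a 0 - cubeTraceCount p a 1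

theorem traceChar_isPrimitive : (traceChar p F).IsPrimitive := by
  apply AddChar.IsPrimitive.of_ne_one
  have : Finite F := inferInstance
  obtain ⟨x, hx⟩ := Algebra.trace_surjective (ZMod p) F 1
  rw [AddChar.ne_one_iff]
  refine ⟨x, ?_⟩
  rw [traceChar_apply, hx, ← AddChar.map_zero_eq_one (ZMod.stdAddChar (N := p))]
  intro h
  exact one_ne_zero (ZMod.injective_stdAddChar h)

variable {p}

/-- The divisibility hypothesis says exactly that `p - 1 ∣ n`, so `c^n = 1` for each nonzero scalar
`c`. -/
theorem scalarsAreCubes {m n : ℕ} (hn : 0 < n) (hr : n * 3 + 1 = p ^ m)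
    (hN : 3 ∣ (p ^ m - 1) / (p - 1)) (hF : Fintype.card F = n * 3 + 1) {α : Fˣ}
    (hα : ∀ x : Fˣ, x ∈ Subgroup.zpowers α) : ScalarsAreCubes p F := by
  intro c hc
  obtain ⟨k, hk⟩ := hN
  have hd : p - 1 ∣ p ^ m - 1 := by simpa using Nat.sub_dvd_pow_sub_pow p 1 m
  have hk' : p ^ m - 1 = (p - 1) * (3 * k) := by rw [← hk, Nat.mul_div_cancel' hd]
  have hn' : n = (p - 1) * k := by
    have : n * 3 = (p - 1) * k * 3 := by rw [mul_assoc, mul_comm k, ← hk', ← hr]; rfl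
    omega
  have hc' : algebraMap (ZMod p) F c ≠ 0 := by simpa using hc
  obtain ⟨y, hy⟩ := (pow_card_third_eq_one_iff hn hF hα (Units.mk0 _ hc')).1 (by
    ext
    rw [hn', pow_mul]
    simp only [Units.val_pow_eq_pow_val, Units.val_mk0, Units.val_one]
    rw [← map_pow, ZMod.pow_card_sub_one_eq_one hc, map_one, one_pow])
  exact ⟨y, by rw [← Units.val_pow_eq_pow_val, hy]; rfl⟩

theorem cubeTraceCount_mul_cube (a : F) (y : Fˣ) (ρ : ZMod p) :
    cubeTraceCount p (a * (y : F) ^ 3) ρ = cubeTraceCount p a ρ := by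
  refine Finset.card_equiv (Equiv.mulLeft₀ (y : F) y.ne_zero) fun x => ?_
  simp [mul_pow, mul_assoc]

theorem cubicSum_mul_cube (a : F) (y : Fˣ) : cubicSum p (a * (y : F) ^ 3) = cubicSum p a := by
  simp only [cubicSum, cubeTraceCount_mul_cube]

/-- If `y³ = ρ⁻¹`, the substitution `x ↦ y x` multiplies the trace by `ρ⁻¹`. -/
theorem cubeTraceCount_eq_one (hcube : ScalarsAreCubes p F) (a : F) {ρ : ZMod p} (hρ : ρ ≠ 0) :
    cubeTraceCount p a ρ = cubeTraceCount p a 1 := by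
  obtain ⟨y, hy⟩ := hcube ρ⁻¹ (inv_ne_zero hρ)
  refine Finset.card_equiv (Equiv.mulLeft₀ (y : F) y.ne_zero) fun x => ?_
  have : a * ((y : F) * x) ^ 3 = ρ⁻¹ • (a * x ^ 3) := by
    rw [mul_pow, hy, Algebra.smul_def]; ring
  have h2 : Algebra.trace (ZMod p) F (a * ((y : F) * x) ^ 3) =
      ρ⁻¹ * Algebra.trace (ZMod p) F (a * x ^ 3) := by rw [this, map_smul, smul_eq_mul]
  simp only [Finset.mem_filter, Finset.mem_univ, true_and, Equiv.mulLeft₀_apply]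
  rw [h2, inv_mul_eq_one₀ hρ, eq_comm]

theorem cubeTraceCount_zero_add (hcube : ScalarsAreCubes p F) (a : F) :
    cubeTraceCount p a 0 + (p - 1) * cubeTraceCount p a 1 = Fintype.card F := by
  rw [← Finset.card_univ, Finset.card_eq_sum_card_fiberwise
    (f := fun x : F => Algebra.trace (ZMod p) F (a * x ^ 3)) (t := Finset.univ)
    (by intro x _; simp), ← Finset.add_sum_erase _ _ (Finset.mem_univ (0 : ZMod p))]
  congr 1
  change _ = ∑ ρ ∈ Finset.univ.erase (0 : ZMod p), cubeTraceCount p a ρ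
  rw [Finset.sum_congr rfl fun ρ hρ => cubeTraceCount_eq_one hcube a (Finset.ne_of_mem_erase hρ)]
  simp [Finset.card_erase_of_mem, ZMod.card]

/-- All nonzero levels have equal size and `∑ ζ^ρ = 0`, so only the excess of the zero level
remains. -/
theorem sum_traceChar_cube (hcube : ScalarsAreCubes p F) (a : F) :
    ∑ x : F, traceChar p F (a * x ^ 3) = cubicSum p a := by
  have h0 : ∑ ρ : ZMod p, ZMod.stdAddChar ρ = (0 : ℂ) := by
    apply AddChar.sum_eq_zero_of_ne_one
    rw [AddChar.ne_one_iff]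
    refine ⟨1, fun h => ?_⟩
    rw [← AddChar.map_zero_eq_one (ZMod.stdAddChar (N := p))] at h
    exact one_ne_zero (ZMod.injective_stdAddChar h)
  have h1 : ∑ x : F, traceChar p F (a * x ^ 3) =
      ∑ ρ : ZMod p, (cubeTraceCount p a ρ : ℂ) * ZMod.stdAddChar ρ := by
    rw [← Finset.sum_fiberwise Finset.univ
      (fun x : F => Algebra.trace (ZMod p) F (a * x ^ 3))]
    refine Finset.sum_congr rfl fun ρ _ => ?_
    rw [Finset.sum_congr rfl (g := fun _ => (ZMod.stdAddChar ρ : ℂ))]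
    · rw [Finset.sum_const, nsmul_eq_mul]; rfl
    · intro x hx
      rw [traceChar_apply, (Finset.mem_filter.1 hx).2]
  have h2 : ∑ ρ : ZMod p, (cubeTraceCount p a ρ : ℂ) * ZMod.stdAddChar ρ =
      ∑ ρ : ZMod p, ((cubeTraceCount p a 1 : ℂ) * ZMod.stdAddChar ρ +
        if ρ = 0 then (cubicSum p a : ℂ) else 0) := by
    refine Finset.sum_congr rfl fun ρ _ => ?_
    split_ifs with h
    · subst h
      simp [cubicSum]
    · rw [cubeTraceCount_eq_one hcube a h, add_zero]
  rw [h1, h2, Finset.sum_add_distrib, ← Finset.mul_sum, h0]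
  simp

theorem sum_sum_traceChar [DecidableEq F] {ι : Type*} [Fintype ι] (f : ι → F) :
    ∑ a : F, ∑ i, traceChar p F (a * f i) =
      (Fintype.card F : ℂ) * ((Finset.univ.filter fun i => f i = 0).card : ℂ) := by
  rw [Finset.sum_comm]
  simp_rw [AddChar.sum_mulShift _ (traceChar_isPrimitive p (F := F))]
  rw [Finset.card_filter]
  push_cast
  rw [Finset.mul_sum]
  refine Finset.sum_congr rfl fun i _ => ?_
  split_ifs <;> simp

theorem sum_cubicSum (hcube : ScalarsAreCubes p F) :
    ∑ a : F, cubicSum p a = (Fintype.card F : ℤ) := by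
  classical
  have h := sum_sum_traceChar (p := p) (fun x : F => x ^ 3)
  simp_rw [sum_traceChar_cube hcube] at h
  have h1 : (Finset.univ.filter fun x : F => x ^ 3 = 0) = {0} := by ext; simp
  rw [h1, Finset.card_singleton, Nat.cast_one, mul_one] at h
  exact_mod_cast h

theorem sum_cubicSum_sq [DecidableEq F] (hcube : ScalarsAreCubes p F) :
    ∑ a : F, cubicSum p a ^ 2 = (Fintype.card F : ℤ) *
      (Finset.univ.filter fun z : F × F => z.1 ^ 3 + z.2 ^ 3 = 0).card := by
  have h := sum_sum_traceChar (p := p) (fun z : F × F => z.1 ^ 3 + z.2 ^ 3)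
  have h1 : ∀ a : F, ∑ z : F × F, traceChar p F (a * (z.1 ^ 3 + z.2 ^ 3)) =
      (cubicSum p a : ℂ) ^ 2 := by
    intro a
    rw [sq, ← sum_traceChar_cube hcube, Finset.sum_mul_sum, ← Fintype.sum_prod_type']
    simp_rw [mul_add, AddChar.map_add_eq_mul]
  simp_rw [h1] at h
  exact_mod_cast h

theorem sum_cubicSum_cube [DecidableEq F] (hcube : ScalarsAreCubes p F) :
    ∑ a : F, cubicSum p a ^ 3 = (Fintype.card F : ℤ) *
      (Finset.univ.filter fun z : F × F × F => z.2.1 ^ 3 + z.2.2 ^ 3 + z.1 ^ 3 = 0).card := by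
  have h := sum_sum_traceChar (p := p) (fun z : F × F × F => z.2.1 ^ 3 + z.2.2 ^ 3 + z.1 ^ 3)
  have h1 : ∀ a : F, ∑ z : F × F × F, traceChar p F (a * (z.2.1 ^ 3 + z.2.2 ^ 3 + z.1 ^ 3)) =
      (cubicSum p a : ℂ) ^ 3 := by
    intro a
    rw [pow_succ', sq, ← sum_traceChar_cube hcube, Finset.sum_mul_sum, Finset.sum_mul_sum,
      Fintype.sum_prod_type]
    refine Finset.sum_congr rfl fun x _ => ?_
    rw [Fintype.sum_prod_type, ← Finset.mul_sum, Finset.mul_sum]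
    refine Finset.sum_congr rfl fun y _ => ?_
    rw [Finset.mul_sum]
    refine Finset.sum_congr rfl fun z _ => ?_
    simp_rw [mul_add, AddChar.map_add_eq_mul]
    ring
  simp_rw [h1] at h
  exact_mod_cast h

theorem card_sum_two_cubes_zero [DecidableEq F] (hcube : ScalarsAreCubes p F) {n : ℕ} (hn : 0 < n)
    (hF : Fintype.card F = n * 3 + 1) {α : Fˣ} (hα : ∀ x : Fˣ, x ∈ Subgroup.zpowers α) :
    (Finset.univ.filter fun z : F × F => z.1 ^ 3 + z.2 ^ 3 = 0).card = 9 * n + 1 := by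
  have hfib : ∀ x : F, ((Finset.univ.filter fun z : F × F => z.1 ^ 3 + z.2 ^ 3 = 0).filter
      fun z => z.1 = x).card = if x = 0 then 1 else 3 := by
    intro x
    have h1 : ((Finset.univ.filter fun z : F × F => z.1 ^ 3 + z.2 ^ 3 = 0).filter
        fun z => z.1 = x) = (Finset.univ.filter fun y : F => y ^ 3 = -x ^ 3).map
          ⟨fun y => (x, y), fun a b h => by simpa using h⟩ := by
      ext ⟨a, b⟩
      simp only [Finset.mem_filter, Finset.mem_univ, true_and, Finset.mem_map]
      constructor
      · rintro ⟨h, rfl⟩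
        exact ⟨b, by linear_combination h, rfl⟩
      · rintro ⟨y, h, e⟩
        obtain ⟨rfl, rfl⟩ := Prod.mk.inj (show (x, y) = (a, b) from e)
        exact ⟨by rw [h]; ring, rfl⟩
    rw [h1, Finset.card_map]
    split_ifs with hx
    · subst hx
      have : (Finset.univ.filter fun y : F => y ^ 3 = -0 ^ 3) = {0} := by ext; simp
      rw [this, Finset.card_singleton]
    · have hne : -x ^ 3 ≠ 0 := by simpa using hx
      rw [card_cube_fiber hn hF hα hne, if_pos]
      obtain ⟨y, hy⟩ := neg_one_isCube hcube
      have := (pow_card_third_eq_one_iff hn hF hα (Units.mk0 _ hne)).2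
        ⟨y * Units.mk0 x hx, by ext; simp [mul_pow, hy]⟩
      simpa using congrArg Units.val this
  rw [Finset.card_eq_sum_card_fiberwise (f := Prod.fst) (t := Finset.univ) (by intro x _; simp)]
  simp_rw [hfib]
  rw [Finset.sum_ite]
  simp only [Finset.sum_const, smul_eq_mul, mul_one]
  have e1 : (Finset.univ.filter fun x : F => x = 0).card = 1 := by
    rw [Finset.filter_eq' Finset.univ (0 : F)]; simp
  have e2 := Finset.card_filter_add_card_filter_not (s := (Finset.univ : Finset F)) (fun x => x = 0)
  rw [e1, Finset.card_univ, hF] at e2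
  rw [e1]
  omega

theorem card_sum_three_cubes_zero [DecidableEq F] (hcube : ScalarsAreCubes p F) {n : ℕ}
    (hn : 0 < n) (hF : Fintype.card F = n * 3 + 1) {α : Fˣ}
    (hα : ∀ x : Fˣ, x ∈ Subgroup.zpowers α) :
    (Finset.univ.filter fun z : F × F × F => z.2.1 ^ 3 + z.2.2 ^ 3 + z.1 ^ 3 = 0).card =
      9 * n + 1 + n * 3 * (Finset.univ.filter fun z : F × F => z.1 ^ 3 + z.2 ^ 3 = 1).card := by
  have hfib : ∀ x : F, ((Finset.univ.filter fun z : F × F × F =>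
      z.2.1 ^ 3 + z.2.2 ^ 3 + z.1 ^ 3 = 0).filter fun z => z.1 = x).card =
        if x = 0 then 9 * n + 1 else
          (Finset.univ.filter fun z : F × F => z.1 ^ 3 + z.2 ^ 3 = 1).card := by
    intro x
    have h1 : ((Finset.univ.filter fun z : F × F × F =>
        z.2.1 ^ 3 + z.2.2 ^ 3 + z.1 ^ 3 = 0).filter fun z => z.1 = x) =
        (Finset.univ.filter fun z : F × F => z.1 ^ 3 + z.2 ^ 3 + x ^ 3 = 0).map
          ⟨fun y => (x, y), fun a b h => by simpa using h⟩ := by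
      ext ⟨a, b⟩
      simp only [Finset.mem_filter, Finset.mem_univ, true_and, Finset.mem_map]
      constructor
      · rintro ⟨h, rfl⟩
        exact ⟨b, h, rfl⟩
      · rintro ⟨y, h, e⟩
        obtain ⟨rfl, rfl⟩ := Prod.mk.inj (show (x, y) = (a, b) from e)
        exact ⟨h, rfl⟩
    rw [h1, Finset.card_map]
    split_ifs with hx
    · subst hx
      rw [← card_sum_two_cubes_zero hcube hn hF hα]
      simp
    · symm
      have hx' : -x ≠ 0 := neg_ne_zero.2 hx
      -- Scaling by `-x` rather than `x` also absorbs the sign, turning `a³ + b³ + x³ = 0` into `a³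
      -- + b³ = 1`.
      refine Finset.card_equiv
        ((Equiv.mulLeft₀ (-x) hx').prodCongr (Equiv.mulLeft₀ (-x) hx')) fun z => ?_
      simp only [Finset.mem_filter, Finset.mem_univ, true_and, Equiv.prodCongr_apply, Prod.map,
        Equiv.mulLeft₀_apply]
      have : (-x * z.1) ^ 3 + (-x * z.2) ^ 3 + x ^ 3 = -x ^ 3 * (z.1 ^ 3 + z.2 ^ 3 - 1) := by ring
      rw [this, mul_eq_zero, sub_eq_zero]
      simp [hx]
  rw [Finset.card_eq_sum_card_fiberwise (f := Prod.fst) (t := Finset.univ) (by intro x _; simp)]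
  simp_rw [hfib]
  rw [Finset.sum_ite]
  simp only [Finset.sum_const, smul_eq_mul]
  have e1 : (Finset.univ.filter fun x : F => x = 0).card = 1 := by
    rw [Finset.filter_eq' Finset.univ (0 : F)]; simp
  have e2 := Finset.card_filter_add_card_filter_not (s := (Finset.univ : Finset F)) (fun x => x = 0)
  rw [e1, Finset.card_univ, hF] at e2
  rw [e1, show (Finset.univ.filter fun x : F => ¬ x = 0).card = n * 3 by omega]
  ring

end TraceCounts

/-! ### Sums over cosets of the cubes -/

section CubeClasses

variable {F : Type*} [Field F] [Fintype F]

theorem sum_range_mul_three {M : Type*} [AddCommMonoid M] (h : ℕ → M) (hh : ∀ k, h (k + 3) = h k)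
    (n : ℕ) : ∑ k ∈ Finset.range (n * 3), h k = n • (h 0 + h 1 + h 2) := by
  have hm : ∀ j c, h (j * 3 + c) = h c := by
    intro j c
    induction j with
    | zero => simp
    | succ j ih => rw [← ih, ← hh (j * 3 + c)]; congr 1; ring
  induction n with
  | zero => simp
  | succ n ih =>
    rw [Nat.succ_mul, Finset.sum_range_succ, Finset.sum_range_succ, Finset.sum_range_succ, ih,
      succ_nsmul, hm n 1, hm n 2]
    have := hm n 0
    rw [add_zero] at this
    rw [this]
    abel

/-- A sum over a finite field of a function that is constant on the cosets of the cubes. -/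
theorem sum_eq_of_cube_invariant {M : Type*} [AddCommMonoid M] {n : ℕ}
    (hF : Fintype.card F = n * 3 + 1) {α : Fˣ} (hα : ∀ x : Fˣ, x ∈ Subgroup.zpowers α)
    (g : F → M) (hg : ∀ (a : F) (y : Fˣ), g (a * (y : F) ^ 3) = g a) :
    ∑ a, g a = g 0 + n • (g 1 + g α + g ((α : F) ^ 2)) := by
  classical
  have h1 : ∑ a ∈ Finset.univ.erase (0 : F), g a = ∑ u : Fˣ, g u := by
    symm
    refine Finset.sum_bij (fun u _ => (u : F)) (by simp) (fun a _ b _ h => Units.ext h) ?_ (by simp)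
    intro b hb
    exact ⟨Units.mk0 b (by simpa using hb), by simp, by simp⟩
  have h2 : ∑ u : Fˣ, g u = ∑ k ∈ Finset.range (n * 3), g ((α ^ k : Fˣ) : F) := by
    rw [← IsCyclic.image_range_orderOf hα, orderOf_generator hF hα, Finset.sum_image]
    intro a ha b hb hab
    refine pow_injOn_Iio_orderOf ?_ ?_ hab <;> rw [orderOf_generator hF hα]
    · simpa using ha
    · simpa using hb
  rw [← Finset.add_sum_erase _ _ (Finset.mem_univ (0 : F)), h1, h2, sum_range_mul_three]
  · simp
  · intro k
    rw [pow_add, Units.val_mul, Units.val_pow_eq_pow_val α 3, hg]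

end CubeClasses

/-! ### Elementary symmetric information on the three cubic sums -/

section Periods

variable {p : ℕ} [Fact p.Prime] {F : Type*} [Field F] [Fintype F] [Algebra (ZMod p) F]

theorem cubicSum_zero : cubicSum p (0 : F) = Fintype.card F := by
  simp [cubicSum, cubeTraceCount, Finset.card_univ]

theorem cubicSum_moment_one (hcube : ScalarsAreCubes p F) {n : ℕ} (hn : 0 < n)
    (hF : Fintype.card F = n * 3 + 1) {α : Fˣ} (hα : ∀ x : Fˣ, x ∈ Subgroup.zpowers α) :
    cubicSum p (1 : F) + cubicSum p (α : F) + cubicSum p ((α : F) ^ 2) = 0 := by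
  have h := sum_cubicSum hcube
  rw [sum_eq_of_cube_invariant hF hα _ cubicSum_mul_cube, cubicSum_zero, nsmul_eq_mul] at h
  have h2 := left_eq_add.1 h.symm
  exact (mul_eq_zero.1 h2).resolve_left (by exact_mod_cast hn.ne')

/-- The total over all `a` is `r(9n + 1)`. Removing `r²` for `a = 0` leaves `6nr`, spread over three
cosets of size `n`. -/
theorem cubicSum_moment_two (hcube : ScalarsAreCubes p F) {n : ℕ} (hn : 0 < n)
    (hF : Fintype.card F = n * 3 + 1) {α : Fˣ} (hα : ∀ x : Fˣ, x ∈ Subgroup.zpowers α) :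
    cubicSum p (1 : F) ^ 2 + cubicSum p (α : F) ^ 2 + cubicSum p ((α : F) ^ 2) ^ 2 =
      6 * Fintype.card F := by
  classical
  have h := sum_cubicSum_sq hcube
  rw [sum_eq_of_cube_invariant hF hα (fun a => cubicSum p a ^ 2)
    (fun a y => by rw [cubicSum_mul_cube]), cubicSum_zero, nsmul_eq_mul,
    card_sum_two_cubes_zero hcube hn hF hα, hF] at h
  have hn' : (n : ℤ) ≠ 0 := by exact_mod_cast hn.ne'
  apply mul_left_cancel₀ hn'
  rw [hF]
  push_cast at h ⊢
  linear_combination h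

theorem cubicSum_moment_three [DecidableEq F] (hcube : ScalarsAreCubes p F) {n : ℕ} (hn : 0 < n)
    (hF : Fintype.card F = n * 3 + 1) {α : Fˣ} (hα : ∀ x : Fˣ, x ∈ Subgroup.zpowers α) :
    cubicSum p (1 : F) ^ 3 + cubicSum p (α : F) ^ 3 + cubicSum p ((α : F) ^ 2) ^ 3 =
      3 * Fintype.card F *
        ((Finset.univ.filter fun z : F × F => z.1 ^ 3 + z.2 ^ 3 = 1).card + 1 - 3 * n) := by
  have h := sum_cubicSum_cube hcube
  rw [sum_eq_of_cube_invariant hF hα (fun a => cubicSum p a ^ 3)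
    (fun a y => by rw [cubicSum_mul_cube]), cubicSum_zero, nsmul_eq_mul,
    card_sum_three_cubes_zero hcube hn hF hα, hF] at h
  have hn' : (n : ℤ) ≠ 0 := by exact_mod_cast hn.ne'
  apply mul_left_cancel₀ hn'
  rw [hF]
  push_cast at h ⊢
  linear_combination h

/-- The product of the three cubic sums is `r T` with `T` prime to `p`. -/
theorem cubicSum_product (hcube : ScalarsAreCubes p F) {m n : ℕ} (hn : 0 < n)
    (hF : Fintype.card F = n * 3 + 1) (hr : p ^ m = n * 3 + 1) (hp3 : p ≡ 1 [MOD 3]) (hm : m ≠ 0)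
    {α : Fˣ} (hα : ∀ x : Fˣ, x ∈ Subgroup.zpowers α) :
    ∃ T : ℤ, cubicSum p (1 : F) * cubicSum p (α : F) * cubicSum p ((α : F) ^ 2) =
      Fintype.card F * T ∧ ¬ (p : ℤ) ∣ T := by
  classical
  have hp : p.Prime := Fact.out
  have h1 := cubicSum_moment_one hcube hn hF hα
  have h3 := cubicSum_moment_three hcube hn hF hα
  -- As the sum vanishes, the product is a third of the cubic moment. Modulo `p`, `3n ≡ -1` and the
  -- point count is `-2 - C(2n, n)`, so this `T` is `-C(2n, n)`.
  refine ⟨(Finset.univ.filter fun z : F × F => z.1 ^ 3 + z.2 ^ 3 = 1).card + 1 - 3 * n, ?_, ?_⟩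
  rotate_left
  · have heven : Even n := by
      have hodd : Odd (p ^ m) := by
        refine (hp.odd_of_ne_two ?_).pow
        rintro rfl
        exact absurd hp3 (by decide)
      rw [hr] at hodd
      rcases Nat.even_or_odd n with h | h
      · exact h
      · exact absurd hodd (by
          rw [Nat.not_odd_iff_even]
          exact (h.mul (by decide)).add_odd (by decide))
    have hc := card_fermat_cubic_cast hn heven hF hα
    intro hdvd
    have : CharP F p := charP_of_injective_algebraMap (algebraMap (ZMod p) F).injective p
    apply not_dvd_centralBinom_third hp hp3 m n hr
    rw [← CharP.cast_eq_zero_iff F p]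
    rw [← CharP.intCast_eq_zero_iff F p] at hdvd
    have h0 : ((n * 3 + 1 : ℕ) : F) = 0 := by
      rw [← hr, Nat.cast_pow, CharP.cast_eq_zero, zero_pow hm]
    push_cast at hdvd h0
    rw [hc] at hdvd
    linear_combination -hdvd - h0
  · have e : cubicSum p ((α : F) ^ 2) = -(cubicSum p (1 : F) + cubicSum p (α : F)) := by
      linear_combination h1
    rw [e] at h3 ⊢
    have h30 : (3 : ℤ) ≠ 0 := by norm_num
    apply mul_left_cancel₀ h30
    linear_combination h3

end Periods

/-! ### Integer triples with zero sum and prescribed sum of squares -/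

section Arithmetic

/-- Each `x` is a root of the cubic `x³ = p^{3k}(3x + T)`. Hence `p ∣ x`, the factor `3x + T` is
prime to `p`, and comparing valuations gives `3 v(x) = 3k`. -/
theorem eq_pow_mul_of_sum_zero {p k : ℕ} (hp : p.Prime) (hk : 0 < k) {x₀ x₁ x₂ T : ℤ}
    (h1 : x₀ + x₁ + x₂ = 0) (h2 : x₀ ^ 2 + x₁ ^ 2 + x₂ ^ 2 = 6 * (p : ℤ) ^ (3 * k))
    (h3 : x₀ * x₁ * x₂ = (p : ℤ) ^ (3 * k) * T) (hT : ¬ (p : ℤ) ∣ T) :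
    ∃ y, x₀ = (p : ℤ) ^ k * y ∧ ¬ (p : ℤ) ∣ y := by
  have hp' : Prime (p : ℤ) := Nat.prime_iff_prime_int.1 hp
  have hp0 : (p : ℤ) ≠ 0 := hp'.ne_zero
  have hc : x₀ ^ 3 = (p : ℤ) ^ (3 * k) * (3 * x₀ + T) := by
    have e : x₂ = -(x₀ + x₁) := by linear_combination h1
    subst e
    have h2' : x₀ ^ 2 + x₁ ^ 2 + x₀ * x₁ = 3 * (p : ℤ) ^ (3 * k) := by linarith
    linear_combination h3 + x₀ * h2'
  have hpx : (p : ℤ) ∣ x₀ := by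
    apply hp'.dvd_of_dvd_pow (n := 3)
    rw [hc]
    exact (dvd_pow_self _ (by omega)).mul_right _
  have hU : ¬ (p : ℤ) ∣ 3 * x₀ + T := fun h => hT ((dvd_add_right (hpx.mul_left 3)).1 h)
  have hx0 : x₀ ≠ 0 := by
    rintro rfl
    apply hT
    have : T = 0 := by simpa [hp.ne_zero, hk.ne'] using hc.symm
    simp [this]
  obtain ⟨j, y, hy, hxy⟩ := (Int.finiteMultiplicity_iff.2
    ⟨by simpa using hp.one_lt.ne', hx0⟩ : FiniteMultiplicity (p : ℤ) x₀).exists_eq_pow_mul_and_not_dvd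
      |> fun ⟨c, h, h'⟩ => (⟨_, c, h', h⟩ : ∃ j c, ¬ (p : ℤ) ∣ c ∧ x₀ = (p : ℤ) ^ j * c)
  have hy3 : ¬ (p : ℤ) ∣ y ^ 3 := fun h => hy (hp'.dvd_of_dvd_pow h)
  rw [hxy, mul_pow, ← pow_mul, mul_comm j 3, ← hxy] at hc
  rcases lt_trichotomy j k with h | h | h
  · exfalso
    obtain ⟨d, rfl⟩ : ∃ d, k = j + (d + 1) := ⟨k - j - 1, by omega⟩
    rw [mul_add 3, pow_add, mul_assoc] at hc
    apply hy3
    rw [mul_left_cancel₀ (pow_ne_zero _ hp0) hc]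
    exact (dvd_pow_self _ (by omega)).mul_right _
  · subst h; exact ⟨y, hxy, hy⟩
  · exfalso
    obtain ⟨d, rfl⟩ : ∃ d, j = k + (d + 1) := ⟨j - k - 1, by omega⟩
    rw [mul_add 3, pow_add, mul_assoc] at hc
    apply hU
    rw [← mul_left_cancel₀ (pow_ne_zero _ hp0) hc]
    exact (dvd_pow_self _ (by omega)).mul_right _

/-- Uniqueness, up to the sign of `t`, of primitive representations `4q = s² + 27t²` of prime
powers. -/
theorem cubic_pair_unique {p k : ℕ} (hp : p.Prime) (hp2 : p ≠ 2) (hp3 : p ≠ 3) (hk : 0 < k)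
    {s t s' t' : ℤ}
    (h : 4 * (p : ℤ) ^ k = s ^ 2 + 27 * t ^ 2) (h' : 4 * (p : ℤ) ^ k = s' ^ 2 + 27 * t' ^ 2)
    (hs : ¬ (p : ℤ) ∣ s) (hs' : ¬ (p : ℤ) ∣ s')
    (hs3 : s ≡ 1 [ZMOD 3]) (hs3' : s' ≡ 1 [ZMOD 3]) :
    s = s' ∧ (t = t' ∨ t = -t') := by
  have hp' : Prime (p : ℤ) := Nat.prime_iff_prime_int.1 hp
  have hpq : (p : ℤ) ∣ (p : ℤ) ^ k := dvd_pow_self _ hk.ne'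
  have hq : 0 < (p : ℤ) ^ k := by have := hp.pos; positivity
  have hp2' : ¬ (p : ℤ) ∣ 2 := fun h => hp2 ((Nat.prime_dvd_prime_iff_eq hp Nat.prime_two).1
    (by exact_mod_cast h))
  have hp3' : ¬ (p : ℤ) ∣ 3 := fun h => hp3 ((Nat.prime_dvd_prime_iff_eq hp Nat.prime_three).1
    (by exact_mod_cast h))
  have main : ∀ t' : ℤ, 4 * (p : ℤ) ^ k = s' ^ 2 + 27 * t' ^ 2 →
      (p : ℤ) ^ k ∣ s * t' - s' * t → s = s' ∧ t = t' := by
    rintro t' h' ⟨d, hd⟩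
    -- Brahmagupta's composition identity: a nonzero multiple of `p^k` in the last square would make
    -- the right side at least `27 p^{2k}`.
    have e : 16 * ((p : ℤ) ^ k) ^ 2 = (s * s' + 27 * t * t') ^ 2 +
        27 * (s * t' - s' * t) ^ 2 := by
      linear_combination (4 * (p : ℤ) ^ k) * h + (s ^ 2 + 27 * t ^ 2) * h'
    have hd0 : d = 0 := by
      by_contra hne
      have h1 : 1 ≤ d ^ 2 := by have := sq_nonneg d; have := pow_ne_zero 2 hne; omega
      rw [hd] at e
      have h2 : 0 ≤ ((p : ℤ) ^ k) ^ 2 * (d ^ 2 - 1) := mul_nonneg (sq_nonneg _) (by linarith)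
      nlinarith [sq_nonneg (s * s' + 27 * t * t'), pow_pos hq 2]
    rw [hd0, mul_zero] at hd
    have hss : (4 * (p : ℤ) ^ k) * (s ^ 2 - s' ^ 2) = 0 := by
      linear_combination s ^ 2 * h' - s' ^ 2 * h + 27 * (s * t' + s' * t) * hd
    have hss' : (s - s') * (s + s') = 0 := by
      have := (mul_eq_zero.1 hss).resolve_left (by positivity)
      linear_combination this
    have hs0 : s ≠ 0 := by rintro rfl; simp at hs
    have hseq : s = s' := by
      rcases mul_eq_zero.1 hss' with h | h
      · linarith
      · unfold Int.ModEq at hs3 hs3'; omega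
    subst hseq
    refine ⟨rfl, ?_⟩
    have := (mul_eq_zero.1 (show s * (t' - t) = 0 by linear_combination hd)).resolve_left hs0
    linarith
  -- If `p` divided both factors, it would divide `t'` and then `s'`. So `p^k` divides one factor
  -- alone, and changing the sign of `t'` exchanges the two.
  have hprod : (p : ℤ) ^ k ∣ (s * t' - s' * t) * (s * t' + s' * t) :=
    ⟨4 * (t' ^ 2 - t ^ 2), by linear_combination t ^ 2 * h' - t' ^ 2 * h⟩
  by_cases hd : (p : ℤ) ∣ s * t' - s' * t
  · have hd' : ¬ (p : ℤ) ∣ s * t' + s' * t := by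
      intro hd'
      have h1 : (p : ℤ) ∣ 2 * (s * t') := by
        have := dvd_add hd hd'
        ring_nf at this ⊢
        exact this
      have ht' : (p : ℤ) ∣ t' :=
        (hp'.dvd_or_dvd ((hp'.dvd_or_dvd h1).resolve_left hp2')).resolve_left hs
      have hs'2 : (p : ℤ) ∣ s' ^ 2 := by
        have e : s' ^ 2 = 4 * (p : ℤ) ^ k - 27 * t' ^ 2 := by linear_combination -h'
        rw [e]
        exact dvd_sub (hpq.mul_left 4) ((dvd_pow ht' two_ne_zero).mul_left 27)
      exact hs' (hp'.dvd_of_dvd_pow hs'2)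
    obtain ⟨rfl, rfl⟩ := main t' h' (hp'.pow_dvd_of_dvd_mul_right k hd' hprod)
    exact ⟨rfl, Or.inl rfl⟩
  · obtain ⟨rfl, hh⟩ := main (-t') (by rw [neg_sq]; exact h') (by
      have := hp'.pow_dvd_of_dvd_mul_left k hd hprod
      rw [← dvd_neg]
      convert this using 1; ring)
    exact ⟨rfl, Or.inr hh⟩

/-- The residues modulo 9 lie in `{1, 4, 7}`, and `1 + 4 + 7` is not `0` there, so two of them
agree. These two differ by `9t`, and the third number is `s`. -/
theorem exists_cubic_pair {q y₀ y₁ y₂ : ℤ} (h1 : y₀ + y₁ + y₂ = 0)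
    (h2 : y₀ ^ 2 + y₁ ^ 2 + y₂ ^ 2 = 6 * q) (h₀ : y₀ ≡ 1 [ZMOD 3]) (h₁ : y₁ ≡ 1 [ZMOD 3])
    (h₂ : y₂ ≡ 1 [ZMOD 3]) :
    ∃ s t u v : ℤ, 4 * q = s ^ 2 + 27 * t ^ 2 ∧ 2 * u = -s - 9 * t ∧ 2 * v = -s + 9 * t ∧
      [y₀, y₁, y₂].Perm [s, u, v] := by
  have key : ∀ y₀ y₁ y₂ : ℤ, y₀ + y₁ + y₂ = 0 → y₀ ^ 2 + y₁ ^ 2 + y₂ ^ 2 = 6 * q →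
      y₁ % 9 = y₂ % 9 → ∃ t, 4 * q = y₀ ^ 2 + 27 * t ^ 2 ∧ 2 * y₁ = -y₀ - 9 * t ∧
        2 * y₂ = -y₀ + 9 * t := by
    intro y₀ y₁ y₂ h1 h2 h3
    obtain ⟨t, ht⟩ : ∃ t, y₂ - y₁ = 9 * t := ⟨(y₂ - y₁) / 9, by omega⟩
    refine ⟨t, ?_, by linarith, by linarith⟩
    have e0 : y₀ = -(2 * y₁ + 9 * t) := by linarith
    have e2 : y₂ = y₁ + 9 * t := by linarith
    subst e0 e2
    linarith
  unfold Int.ModEq at h₀ h₁ h₂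
  have : y₁ % 9 = y₂ % 9 ∨ y₂ % 9 = y₀ % 9 ∨ y₀ % 9 = y₁ % 9 := by omega
  rcases this with h | h | h
  · obtain ⟨t, e1, e2, e3⟩ := key y₀ y₁ y₂ h1 h2 h
    exact ⟨_, t, _, _, e1, e2, e3, List.Perm.refl _⟩
  · obtain ⟨t, e1, e2, e3⟩ := key y₁ y₂ y₀ (by linarith) (by linarith) h
    exact ⟨_, t, _, _, e1, e2, e3, (List.perm_append_comm (l₁ := [y₀]) (l₂ := [y₁, y₂]))⟩
  · obtain ⟨t, e1, e2, e3⟩ := key y₂ y₀ y₁ (by linarith) (by linarith) h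
    exact ⟨_, t, _, _, e1, e2, e3, (List.perm_append_comm (l₁ := [y₀, y₁]) (l₂ := [y₂]))⟩

/-- Otherwise `y/x` would have order 3 modulo `p`, forcing `3 ∣ p - 1`. -/
theorem dvd_of_dvd_eisenstein_norm {p : ℕ} (hp : p.Prime) (hp3 : p ≡ 2 [MOD 3]) {x y : ℤ}
    (h : (p : ℤ) ∣ x ^ 2 + x * y + y ^ 2) : (p : ℤ) ∣ x := by
  have := Fact.mk hp
  by_contra hx
  rw [← ZMod.intCast_zmod_eq_zero_iff_dvd] at h hx
  push_cast at h
  set a := (x : ZMod p)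
  set b := (y : ZMod p)
  have ht : (b / a) ^ 2 + b / a + 1 = 0 := by
    field_simp
    linear_combination h
  have ht1 : b / a ≠ 1 := by
    intro h1
    rw [h1] at ht
    have h3 : ((3 : ℕ) : ZMod p) = 0 := by push_cast; linear_combination ht
    rw [ZMod.natCast_eq_zero_iff, Nat.prime_dvd_prime_iff_eq hp Nat.prime_three] at h3
    subst h3
    exact absurd hp3 (by decide)
  have ht0 : b / a ≠ 0 := by
    intro h1
    rw [h1] at ht
    simp at ht
  have ho : orderOf (b / a) = 3 := orderOf_eq_prime (by linear_combination (b / a - 1) * ht) ht1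
  have := ZMod.orderOf_dvd_card_sub_one ht0
  rw [ho] at this
  have := hp.two_le
  unfold Nat.ModEq at hp3
  omega

theorem perm_of_sum_sq_eq_six {x₀ x₁ x₂ : ℤ} (h1 : x₀ + x₁ + x₂ = 0)
    (h2 : x₀ ^ 2 + x₁ ^ 2 + x₂ ^ 2 = 6) :
    [x₀, x₁, x₂].Perm [1, 1, -2] ∨ [x₀, x₁, x₂].Perm [-1, -1, 2] := by
  have b0 : -2 ≤ x₀ ∧ x₀ ≤ 2 := by constructor <;> nlinarith [sq_nonneg x₁, sq_nonneg x₂]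
  have b1 : -2 ≤ x₁ ∧ x₁ ≤ 2 := by constructor <;> nlinarith [sq_nonneg x₀, sq_nonneg x₂]
  obtain ⟨l0, u0⟩ := b0
  obtain ⟨l1, u1⟩ := b1
  obtain rfl : x₂ = -(x₀ + x₁) := by linarith
  interval_cases x₀ <;> interval_cases x₁ <;> first | (exfalso; revert h2; decide) | decide

/-- Eliminating `x₂` gives `x₀² + x₀x₁ + x₁² = 3p^{2k}`. Inertness lets `p` be divided out of the
triple until the sum of squares is `6`. -/
theorem perm_of_sum_zero_of_inert {p : ℕ} (hp : p.Prime) (hp3 : p ≡ 2 [MOD 3]) (k : ℕ) :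
    ∀ x₀ x₁ x₂ : ℤ, x₀ + x₁ + x₂ = 0 → x₀ ^ 2 + x₁ ^ 2 + x₂ ^ 2 = 6 * (p : ℤ) ^ (2 * k) →
      [x₀, x₁, x₂].Perm [(p : ℤ) ^ k, (p : ℤ) ^ k, -2 * (p : ℤ) ^ k] ∨
      [x₀, x₁, x₂].Perm [-(p : ℤ) ^ k, -(p : ℤ) ^ k, 2 * (p : ℤ) ^ k] := by
  have hp0 : (p : ℤ) ≠ 0 := by exact_mod_cast hp.ne_zero
  induction k with
  | zero =>
    intro x₀ x₁ x₂ h1 h2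
    simpa using perm_of_sum_sq_eq_six h1 (by simpa using h2)
  | succ k ih =>
    intro x₀ x₁ x₂ h1 h2
    obtain rfl : x₂ = -(x₀ + x₁) := by linarith
    have h3 : x₀ ^ 2 + x₀ * x₁ + x₁ ^ 2 = (p : ℤ) * (3 * (p : ℤ) ^ (2 * k + 1)) := by
      have : (p : ℤ) ^ (2 * (k + 1)) = p * (p : ℤ) ^ (2 * k + 1) := by ring
      rw [this] at h2
      linarith
    obtain ⟨a, rfl⟩ := dvd_of_dvd_eisenstein_norm hp hp3 (Dvd.intro _ h3.symm)
    obtain ⟨b, rfl⟩ := dvd_of_dvd_eisenstein_norm hp hp3 (x := x₁) (y := p * a)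
      ⟨_, by rw [← h3]; ring⟩
    have h4 : a ^ 2 + b ^ 2 + (-(a + b)) ^ 2 = 6 * (p : ℤ) ^ (2 * k) := by
      apply mul_left_cancel₀ (pow_ne_zero 2 hp0)
      linear_combination h2
    have e : ∀ x y z : ℤ, [a, b, -(a + b)].Perm [x, y, z] →
        [p * a, p * b, -(p * a + p * b)].Perm [p * x, p * y, p * z] := by
      intro x y z h
      have := h.map (fun x => (p : ℤ) * x)
      simpa [mul_add, mul_comm, mul_left_comm] using this
    refine (ih a b _ (by ring) h4).imp (fun h => ?_) (fun h => ?_)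
    · convert e _ _ _ h using 1; ring_nf
    · convert e _ _ _ h using 1; ring_nf

end Arithmetic

/-! ### The trace code: enumeration, weights, dimension, cyclicity -/

section Code

theorem mem_cyclotomicClass_three {F : Type*} [Field F] [Fintype F] {α : Fˣ}
    (hα : ∀ x : Fˣ, x ∈ Subgroup.zpowers α) (i : ℕ) (x : F) :
    x ∈ cyclotomicClass α 3 i ↔ ∃ y : Fˣ, x = (α : F) ^ i * (y : F) ^ 3 := by
  simp only [cyclotomicClass, Finset.mem_filter, Finset.mem_univ, true_and]
  constructor
  · rintro ⟨u, hu, rfl⟩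
    obtain ⟨y, rfl⟩ := (mem_zpowers_cube_iff hα u).1 hu
    exact ⟨y, by simp⟩
  · rintro ⟨y, rfl⟩
    exact ⟨y ^ 3, (mem_zpowers_cube_iff hα _).2 ⟨y, rfl⟩, by simp⟩

theorem definingSet_singleton {F : Type*} [Field F] [Fintype F] (α : Fˣ) (N i : ℕ) :
    definingSet α N {i} = cyclotomicClass α N i := by
  ext x
  simp [definingSet]

section Enumeration

variable {F : Type*} [Field F] [Fintype F]

theorem exists_equiv_cyclotomicClass {n : ℕ} (hn : 0 < n) (hF : Fintype.card F = n * 3 + 1)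
    {α : Fˣ} (hα : ∀ x : Fˣ, x ∈ Subgroup.zpowers α) (i : ℕ) :
    ∃ e : Fin n ≃ cyclotomicClass α 3 i, ∀ j : Fin n, (e j : F) = (α : F) ^ (i + 3 * (j : ℕ)) := by
  have ho := orderOf_generator hF hα
  let f : Fin n → cyclotomicClass α 3 i := fun j =>
    ⟨(α : F) ^ (i + 3 * (j : ℕ)), (mem_cyclotomicClass_three hα i _).2
      ⟨α ^ (j : ℕ), by rw [Units.val_pow_eq_pow_val, pow_add, ← pow_mul, mul_comm 3]⟩⟩
  have hf : Function.Bijective f := by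
    constructor
    · intro j k hjk
      have h : (α : F) ^ (i + 3 * (j : ℕ)) = (α : F) ^ (i + 3 * (k : ℕ)) := congrArg Subtype.val hjk
      rw [pow_add, pow_add] at h
      have h' := mul_left_cancel₀ (pow_ne_zero i α.ne_zero) h
      have h2 : α ^ (3 * (j : ℕ)) = α ^ (3 * (k : ℕ)) := by ext; simpa using h'
      have hj := j.2
      have hk := k.2
      have := pow_injOn_Iio_orderOf (x := α) (by rw [ho, Set.mem_Iio]; omega)
        (by rw [ho, Set.mem_Iio]; omega) h2
      ext
      omega
    · rintro ⟨x, hx⟩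
      obtain ⟨y, rfl⟩ := (mem_cyclotomicClass_three hα i x).1 hx
      obtain ⟨k, rfl⟩ := mem_powers_iff_mem_zpowers.2 (hα y)
      refine ⟨⟨k % n, Nat.mod_lt _ hn⟩, Subtype.ext ?_⟩
      have h1 : α ^ (3 * (k % n)) = α ^ (3 * k) := by
        rw [pow_eq_pow_iff_modEq, ho, mul_comm n]
        exact (Nat.mod_modEq k n).mul_left' 3
      have h2 := congrArg Units.val h1
      simp only [Units.val_pow_eq_pow_val] at h2
      simp only [f]
      rw [pow_add, h2, Units.val_pow_eq_pow_val, ← pow_mul, mul_comm k]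
  exact ⟨Equiv.ofBijective f hf, fun j => rfl⟩

theorem pow_finRotate {n : ℕ} (hF : Fintype.card F = n * 3 + 1) {α : Fˣ}
    (hα : ∀ x : Fˣ, x ∈ Subgroup.zpowers α) (i : ℕ) (j : Fin n) :
    (α : F) ^ (i + 3 * (finRotate n j : ℕ)) = (α : F) ^ 3 * (α : F) ^ (i + 3 * (j : ℕ)) := by
  have ho := orderOf_generator hF hα
  cases n with
  | zero => exact j.elim0
  | succ n =>
    rw [coe_finRotate]
    split_ifs with h
    · subst h
      have h1 := pow_orderOf_eq_one α
      rw [ho] at h1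
      have h2 : (α : F) ^ ((n + 1) * 3) = 1 := by
        rw [← Units.val_pow_eq_pow_val, h1, Units.val_one]
      rw [← pow_add, Fin.val_last, show 3 + (i + 3 * n) = (n + 1) * 3 + i by ring, pow_add _ _ i, h2]
      simp
    · ring

end Enumeration

variable {p : ℕ} [Fact p.Prime] {F : Type*} [Field F] [Fintype F] [Algebra (ZMod p) F]

/-- The codeword `(Tr (x d))_{d ∈ D}` as a linear function of `x`. -/
noncomputable def traceWord (p : ℕ) [Fact p.Prime] {F : Type*} [Field F] [Algebra (ZMod p) F]
    (D : Finset F) : F →ₗ[ZMod p] (D → ZMod p) :=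
  LinearMap.pi fun d : D => (Algebra.trace (ZMod p) F) ∘ₗ (LinearMap.mulRight (ZMod p) (d : F))

/-- The map `y ↦ α^i y³` is three-to-one from nonzero elements onto the class; `y = 0` accounts for
the extra `1` at `ρ = 0`. -/
theorem cubeTraceCount_eq_card {n : ℕ} (hn : 0 < n) (hF : Fintype.card F = n * 3 + 1)
    {α : Fˣ} (hα : ∀ x : Fˣ, x ∈ Subgroup.zpowers α) (i : ℕ) (x : F) (ρ : ZMod p) :
    cubeTraceCount p (x * (α : F) ^ i) ρ = (if ρ = 0 then 1 else 0) +
      3 * (Finset.univ.filter fun d : cyclotomicClass α 3 i =>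
        traceWord p (cyclotomicClass α 3 i) x d = ρ).card := by
  classical
  have hA : ((Finset.univ.filter fun d : cyclotomicClass α 3 i =>
      traceWord p (cyclotomicClass α 3 i) x d = ρ)).card =
      ((cyclotomicClass α 3 i).filter fun d => Algebra.trace (ZMod p) F (x * d) = ρ).card := by
    rw [← Finset.card_map (Function.Embedding.subtype _)]
    congr 1
    ext d
    simp only [Finset.mem_map, Finset.mem_filter, Finset.mem_univ, true_and]
    constructor
    · rintro ⟨a, h, rfl⟩
      exact ⟨a.2, h⟩
    · rintro ⟨hd, h⟩
      exact ⟨⟨d, hd⟩, h, rfl⟩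
  rw [hA, cubeTraceCount, ← Finset.card_filter_add_card_filter_not (fun y : F => y = 0)]
  congr 1
  · split_ifs with h
    · rw [Finset.card_eq_one]
      exact ⟨0, by ext y; simp only [Finset.mem_filter, Finset.mem_univ, true_and,
        Finset.mem_singleton, and_iff_right_iff_imp]; rintro rfl; simp [h]⟩
    · rw [Finset.card_eq_zero, Finset.filter_eq_empty_iff]
      rintro y hy rfl
      simp only [Finset.mem_filter, Finset.mem_univ, true_and] at hy
      apply h
      rw [← hy]
      simp
  · have hαi : (α : F) ^ i ≠ 0 := pow_ne_zero i α.ne_zero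
    rw [Finset.card_eq_sum_card_fiberwise (f := fun y : F => (α : F) ^ i * y ^ 3)
      (t := (cyclotomicClass α 3 i).filter fun d => Algebra.trace (ZMod p) F (x * d) = ρ)]
    · refine (Finset.sum_const_nat fun d hd => ?_).trans (Nat.mul_comm _ 3)
      rw [Finset.mem_filter] at hd
      obtain ⟨hd1, hd2⟩ := hd
      obtain ⟨y, rfl⟩ := (mem_cyclotomicClass_three hα i d).1 hd1
      have hy3 : (y : F) ^ 3 ≠ 0 := pow_ne_zero 3 y.ne_zero
      have := card_cube_fiber hn hF hα hy3
      have hy := congrArg Units.val ((pow_card_third_eq_one_iff hn hF hα (y ^ 3)).2 ⟨y, rfl⟩)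
      rw [if_pos (by simpa using hy)] at this
      refine Eq.trans (congrArg Finset.card ?_) this
      ext z
      simp only [Finset.mem_filter, Finset.mem_univ, true_and]
      constructor
      · rintro ⟨_, h⟩
        exact mul_left_cancel₀ hαi h
      · intro h
        refine ⟨⟨by rw [h, mul_assoc]; exact hd2, ?_⟩, by rw [h]⟩
        rintro rfl
        exact hy3 (by rw [← h]; simp)
    · intro y hy
      simp only [Finset.coe_filter, Finset.mem_filter, Finset.mem_univ, true_and,
        Set.mem_ofPred_eq] at hy ⊢
      exact ⟨(mem_cyclotomicClass_three hα i _).2 ⟨Units.mk0 y hy.2, rfl⟩,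
        by rw [← mul_assoc]; exact hy.1⟩

/-- The monomial `w_0 ^ a ∏ w_ρ ^ b` with `a + (p - 1) b = n` and `1 + 3 (a - b) = S`. -/
noncomputable def periodMonomial (p n : ℕ) [Fact p.Prime] (S : ℤ) : MvPolynomial (ZMod p) ℤ :=
  -- Solving the two linear relations gives `b = (3n + 1 - S)/(3p)`. The division is exact and
  -- nonnegative whenever `S` comes from actual counts.
  balancedMonomial p (n - (p - 1) * ((n * 3 + 1 - S) / (3 * p)).toNat)
    ((n * 3 + 1 - S) / (3 * p)).toNat

theorem periodMonomial_eq {n a b : ℕ} {S : ℤ} (h : a + (p - 1) * b = n)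
    (hS : S = 1 + 3 * (a - b)) : periodMonomial p n S = balancedMonomial p a b := by
  have hp : p.Prime := Fact.out
  have hp1 : ((p - 1 : ℕ) : ℤ) = p - 1 := by push_cast [hp.one_lt.le]; ring
  have hb : ((n * 3 + 1 - S) / (3 * p)).toNat = b := by
    have : (n * 3 + 1 - S : ℤ) = b * (3 * p) := by
      rw [← h, hS]; push_cast; rw [hp1]; ring
    rw [this, Int.mul_ediv_cancel _ (by have := hp.pos; positivity), Int.toNat_natCast]
  rw [periodMonomial, hb]
  congr 1
  omega

theorem exists_counts (hcube : ScalarsAreCubes p F) {n : ℕ} (hn : 0 < n)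
    (hF : Fintype.card F = n * 3 + 1) {α : Fˣ} (hα : ∀ x : Fˣ, x ∈ Subgroup.zpowers α) (i : ℕ)
    (x : F) :
    ∃ a b : ℕ, a + (p - 1) * b = n ∧ cubicSum p (x * (α : F) ^ i) = 1 + 3 * (a - b) ∧
      (Finset.univ.filter fun d : cyclotomicClass α 3 i =>
        traceWord p (cyclotomicClass α 3 i) x d = 0).card = a ∧
      wordCWE (traceWord p (cyclotomicClass α 3 i) x) = balancedMonomial p a b := by
  set Z : ZMod p → ℕ := fun ρ => (Finset.univ.filter fun d : cyclotomicClass α 3 i =>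
        traceWord p (cyclotomicClass α 3 i) x d = ρ).card with hZ
  have hc : ∀ ρ, cubeTraceCount p (x * (α : F) ^ i) ρ = (if ρ = 0 then 1 else 0) + 3 * Z ρ :=
    cubeTraceCount_eq_card hn hF hα i x
  have h0 := hc 0
  have h1 := hc 1
  rw [if_pos rfl] at h0
  rw [if_neg one_ne_zero] at h1
  have hne : ∀ ρ, ρ ≠ 0 → Z ρ = Z 1 := by
    intro ρ hρ
    have h2 := hc ρ
    rw [if_neg hρ, cubeTraceCount_eq_one hcube _ hρ] at h2
    omega
  refine ⟨Z 0, Z 1, ?_, ?_, rfl, ?_⟩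
  · have h := cubeTraceCount_zero_add hcube (x * (α : F) ^ i)
    rw [h0, h1, hF] at h
    have : 3 * (Z 0 + (p - 1) * Z 1) = 3 * n := by
      have : 1 + 3 * Z 0 + (p - 1) * (0 + 3 * Z 1) = 3 * (Z 0 + (p - 1) * Z 1) + 1 := by ring
      omega
    omega
  · rw [cubicSum, h0, h1]
    push_cast
    ring
  · rw [wordCWE, ← Finset.mul_prod_erase _ _ (Finset.mem_univ (0 : ZMod p)), balancedMonomial]
    congr 1
    refine Finset.prod_congr rfl fun ρ hρ => ?_
    rw [← hne ρ (Finset.ne_of_mem_erase hρ)]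

theorem cubicSum_sq_le (hcube : ScalarsAreCubes p F) {n : ℕ} (hn : 0 < n)
    (hF : Fintype.card F = n * 3 + 1) {α : Fˣ} (hα : ∀ x : Fˣ, x ∈ Subgroup.zpowers α) (u : Fˣ) :
    cubicSum p (u : F) ^ 2 ≤ 6 * Fintype.card F := by
  have h := cubicSum_moment_two hcube hn hF hα
  obtain ⟨k, rfl⟩ := mem_powers_iff_mem_zpowers.2 (hα u)
  have e : ((α ^ k : Fˣ) : F) = (α : F) ^ (k % 3) * ((α ^ (k / 3) : Fˣ) : F) ^ 3 := by
    rw [Units.val_pow_eq_pow_val, Units.val_pow_eq_pow_val, ← pow_mul, ← pow_add]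
    congr 1
    omega
  simp only
  rw [e, cubicSum_mul_cube, ← h]
  have h0 := sq_nonneg (cubicSum p (1 : F))
  have h1 := sq_nonneg (cubicSum p (α : F))
  have h2 := sq_nonneg (cubicSum p ((α : F) ^ 2))
  have : k % 3 = 0 ∨ k % 3 = 1 ∨ k % 3 = 2 := by omega
  rcases this with h | h | h <;> rw [h]
  · rw [pow_zero]; linarith
  · rw [pow_one]; linarith
  · linarith

/-- A nonzero `x` with zero word would have cubic sum `r`, against the bound `S² ≤ 6r`, since `n ≥
2` gives `r ≥ 7`. -/
theorem traceWord_injective (hcube : ScalarsAreCubes p F) {n : ℕ} (hn : 1 < n)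
    (hF : Fintype.card F = n * 3 + 1) {α : Fˣ} (hα : ∀ x : Fˣ, x ∈ Subgroup.zpowers α) (i : ℕ) :
    Function.Injective (traceWord p (cyclotomicClass α 3 i)) := by
  rw [injective_iff_map_eq_zero]
  intro x hx
  by_contra hx0
  obtain ⟨a, b, hab, hS, ha, -⟩ := exists_counts hcube (by omega) hF hα i x
  obtain ⟨e, -⟩ := exists_equiv_cyclotomicClass (by omega) hF hα i
  have hcard : Fintype.card (cyclotomicClass α 3 i) = n := by
    rw [← Fintype.card_congr e, Fintype.card_fin]
  have han : a = n := by
    rw [← ha, hx]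
    simpa using hcard
  have hp : p.Prime := Fact.out
  have hb : b = 0 := by
    have : (p - 1) * b = 0 := by omega
    rcases mul_eq_zero.1 this with h | h
    · have := hp.one_lt; omega
    · exact h
  have := cubicSum_sq_le hcube (by omega) hF hα (Units.mk0 x hx0 * α ^ i)
  rw [Units.val_mul, Units.val_mk0, Units.val_pow_eq_pow_val, hS, hF, han, hb] at this
  push_cast at this
  have hn' : (2 : ℤ) ≤ n := by exact_mod_cast hn
  nlinarith

/-- The complete weight enumerator in terms of the three cubic sums. -/
theorem codeCWE_eq (hcube : ScalarsAreCubes p F) {n : ℕ} (hn : 1 < n)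
    (hF : Fintype.card F = n * 3 + 1) {α : Fˣ} (hα : ∀ x : Fˣ, x ∈ Subgroup.zpowers α) (i : ℕ) :
    codeCWE (traceCode p (cyclotomicClass α 3 i)) = MvPolynomial.X 0 ^ n +
      (n : MvPolynomial (ZMod p) ℤ) *
        (([cubicSum p (1 : F), cubicSum p (α : F), cubicSum p ((α : F) ^ 2)].map
          (periodMonomial p n)).sum) := by
  classical
  have h1 : codeCWE (traceCode p (cyclotomicClass α 3 i)) =
      ∑ x : F, wordCWE (traceWord p (cyclotomicClass α 3 i) x) := by
    rw [codeCWE]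
    symm
    refine Finset.sum_bij (fun x _ => traceWord p (cyclotomicClass α 3 i) x) ?_ ?_ ?_ ?_
    · intro x _
      simp only [Finset.mem_filter, Finset.mem_univ, true_and]
      exact ⟨x, rfl⟩
    · intro x _ y _ h
      exact traceWord_injective hcube hn hF hα i h
    · intro c hc
      simp only [Finset.mem_filter, Finset.mem_univ, true_and] at hc
      obtain ⟨x, rfl⟩ := hc
      exact ⟨x, Finset.mem_univ _, rfl⟩
    · intro x _
      rfl
  have h2 : ∀ x : F, wordCWE (traceWord p (cyclotomicClass α 3 i) x) =
      periodMonomial p n (cubicSum p (x * (α : F) ^ i)) := by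
    intro x
    obtain ⟨a, b, hab, hS, -, hw⟩ := exists_counts hcube (by omega) hF hα i x
    rw [hw, periodMonomial_eq hab hS]
  rw [h1]
  simp_rw [h2]
  -- Replacing `x α^i` by `x` removes the dependence on the class. The term at zero has cubic sum
  -- `r` and yields `w_0^n`.
  rw [Fintype.sum_equiv (Equiv.mulRight₀ ((α : F) ^ i) (pow_ne_zero i α.ne_zero))
    (fun x => periodMonomial p n (cubicSum p (x * (α : F) ^ i)))
    (fun x => periodMonomial p n (cubicSum p x)) (fun x => rfl),
    sum_eq_of_cube_invariant hF hα _ (fun a y => by rw [cubicSum_mul_cube]), nsmul_eq_mul,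
    cubicSum_zero, periodMonomial_eq (a := n) (b := 0) (by simp) (by rw [hF]; push_cast; ring)]
  simp [balancedMonomial, add_assoc]

theorem cubicSum_valid (hcube : ScalarsAreCubes p F) {n : ℕ} (hn : 0 < n)
    (hF : Fintype.card F = n * 3 + 1) {α : Fˣ} (hα : ∀ x : Fˣ, x ∈ Subgroup.zpowers α) (x : F) :
    ∃ a b : ℕ, a + (p - 1) * b = n ∧ cubicSum p x = 1 + 3 * (a - b) := by
  obtain ⟨a, b, hab, hS, -⟩ := exists_counts hcube hn hF hα 0 x
  exact ⟨a, b, hab, by simpa using hS⟩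

theorem traceCode_finrank (hcube : ScalarsAreCubes p F) {n : ℕ} (hn : 1 < n)
    (hF : Fintype.card F = n * 3 + 1) {α : Fˣ} (hα : ∀ x : Fˣ, x ∈ Subgroup.zpowers α) (i : ℕ) :
    Module.finrank (ZMod p) (traceCode p (cyclotomicClass α 3 i)) = Module.finrank (ZMod p) F :=
  LinearMap.finrank_range_of_inj (traceWord_injective hcube hn hF hα i)

theorem traceCode_cyclic {n : ℕ} (hF : Fintype.card F = n * 3 + 1) {α : Fˣ}
    (hα : ∀ x : Fˣ, x ∈ Subgroup.zpowers α) (i : ℕ) (e : Fin n ≃ cyclotomicClass α 3 i)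
    (he : ∀ j : Fin n, (e j : F) = (α : F) ^ (i + 3 * (j : ℕ))) :
    IsCyclicCode ((traceCode p (cyclotomicClass α 3 i)).map
      (LinearMap.funLeft (ZMod p) (ZMod p) e)) := by
  rintro c ⟨_, ⟨x, rfl⟩, rfl⟩
  -- Rotating the index multiplies the defining element by `α³`, so the shifted word belongs to `x
  -- α⁻³`.
  refine ⟨_, ⟨x * ((α : F) ^ 3)⁻¹, rfl⟩, ?_⟩
  ext j
  obtain ⟨k, rfl⟩ := (finRotate n).surjective j
  simp only [LinearMap.funLeft_apply, LinearMap.pi_apply, LinearMap.comp_apply,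
    LinearMap.mulRight_apply, Function.comp_apply, Equiv.symm_apply_apply]
  rw [he, he, pow_finRotate hF hα, mul_assoc, inv_mul_cancel_left₀ (pow_ne_zero 3 α.ne_zero)]

end Code

/-! ### Values of the three cubic sums and the enumerators -/

section Main

theorem cast_counts {p n a b : ℕ} (hp : p.Prime) {S : ℤ} (h : a + (p - 1) * b = n)
    (hS : S = 1 + 3 * (a - b)) :
    (a : ℝ) = n / p - (p - 1) / (3 * p) * (1 - S) ∧ (b : ℝ) = n / p + 1 / (3 * p) * (1 - S) := by
  have hp0 : (p : ℝ) ≠ 0 := by exact_mod_cast hp.ne_zero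
  have h' : (n : ℝ) = a + (p - 1) * b := by
    rw [← h]
    push_cast [hp.one_lt.le]
    ring
  rw [h', hS]
  push_cast
  constructor <;> field_simp <;> ring

variable {p : ℕ} [Fact p.Prime] {F : Type*} [Field F] [Fintype F] [Algebra (ZMod p) F]

theorem codeCWE_eq_of_perm (hcube : ScalarsAreCubes p F) {n : ℕ} (hn : 1 < n)
    (hF : Fintype.card F = n * 3 + 1) {α : Fˣ} (hα : ∀ x : Fˣ, x ∈ Subgroup.zpowers α) (i : ℕ)
    {X Y Z : ℤ}
    (hperm : [cubicSum p (1 : F), cubicSum p (α : F), cubicSum p ((α : F) ^ 2)].Perm [X, Y, Z]) :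
    ∃ a₁ b₁ a₂ b₂ a₃ b₃ : ℕ,
      ((a₁ : ℝ) = n / p - (p - 1) / (3 * p) * (1 - X) ∧
        (b₁ : ℝ) = n / p + 1 / (3 * p) * (1 - X)) ∧
      ((a₂ : ℝ) = n / p - (p - 1) / (3 * p) * (1 - Y) ∧
        (b₂ : ℝ) = n / p + 1 / (3 * p) * (1 - Y)) ∧
      ((a₃ : ℝ) = n / p - (p - 1) / (3 * p) * (1 - Z) ∧
        (b₃ : ℝ) = n / p + 1 / (3 * p) * (1 - Z)) ∧
      codeCWE (traceCode p (cyclotomicClass α 3 i)) =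
        MvPolynomial.X 0 ^ n
          + (n : MvPolynomial (ZMod p) ℤ) * balancedMonomial p a₁ b₁
          + (n : MvPolynomial (ZMod p) ℤ) * balancedMonomial p a₂ b₂
          + (n : MvPolynomial (ZMod p) ℤ) * balancedMonomial p a₃ b₃ := by
  have hp : p.Prime := Fact.out
  have hv : ∀ S ∈ [X, Y, Z], ∃ a b : ℕ, a + (p - 1) * b = n ∧ S = 1 + 3 * (a - b) := by
    intro S hS
    rw [← hperm.mem_iff] at hS
    simp only [List.mem_cons, List.not_mem_nil, or_false] at hS
    rcases hS with rfl | rfl | rfl <;> exact cubicSum_valid hcube (by omega) hF hα _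
  obtain ⟨a₁, b₁, h1, h1'⟩ := hv X (by simp)
  obtain ⟨a₂, b₂, h2, h2'⟩ := hv Y (by simp)
  obtain ⟨a₃, b₃, h3, h3'⟩ := hv Z (by simp)
  refine ⟨a₁, b₁, a₂, b₂, a₃, b₃, cast_counts hp h1 h1', cast_counts hp h2 h2',
    cast_counts hp h3 h3', ?_⟩
  rw [codeCWE_eq hcube hn hF hα, (hperm.map _).sum_eq]
  simp only [List.map_cons, List.map_nil, List.sum_cons, List.sum_nil]
  rw [periodMonomial_eq h1 h1', periodMonomial_eq h2 h2', periodMonomial_eq h3 h3']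
  ring

theorem cubicSum_modEq_one (hcube : ScalarsAreCubes p F) {n : ℕ} (hn : 0 < n)
    (hF : Fintype.card F = n * 3 + 1) {α : Fˣ} (hα : ∀ x : Fˣ, x ∈ Subgroup.zpowers α) (x : F) :
    cubicSum p x ≡ 1 [ZMOD 3] := by
  obtain ⟨a, b, -, h⟩ := cubicSum_valid hcube hn hF hα x
  rw [h]
  unfold Int.ModEq
  omega

/-- The shape of the three cubic sums when `p ≡ 1 (mod 3)`. -/
theorem cubicSum_perm_split (hcube : ScalarsAreCubes p F) {n k : ℕ} (hn : 0 < n)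
    (hF : Fintype.card F = n * 3 + 1) (hr : p ^ (3 * k) = n * 3 + 1) (hk : 0 < k)
    (hp3 : p ≡ 1 [MOD 3]) {α : Fˣ} (hα : ∀ x : Fˣ, x ∈ Subgroup.zpowers α) :
    ∃ s t u v : ℤ, 4 * (p : ℤ) ^ k = s ^ 2 + 27 * t ^ 2 ∧ s ≡ 1 [ZMOD 3] ∧ ¬ (p : ℤ) ∣ s ∧
      2 * u = -s - 9 * t ∧ 2 * v = -s + 9 * t ∧
      [cubicSum p (1 : F), cubicSum p (α : F), cubicSum p ((α : F) ^ 2)].Perm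
        [(p : ℤ) ^ k * s, (p : ℤ) ^ k * u, (p : ℤ) ^ k * v] := by
  have hp : p.Prime := Fact.out
  have hp0 : (p : ℤ) ≠ 0 := by exact_mod_cast hp.ne_zero
  have hcard : (Fintype.card F : ℤ) = (p : ℤ) ^ (3 * k) := by rw [hF, ← hr]; push_cast; rfl
  have h1 := cubicSum_moment_one hcube hn hF hα
  have h2 := cubicSum_moment_two hcube hn hF hα
  obtain ⟨T, h3, hT⟩ := cubicSum_product hcube hn hF hr hp3 (by omega) hα
  have m0 := cubicSum_modEq_one hcube hn hF hα 1
  have m1 := cubicSum_modEq_one hcube hn hF hα α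
  have m2 := cubicSum_modEq_one hcube hn hF hα ((α : F) ^ 2)
  rw [hcard] at h2 h3
  generalize cubicSum p (1 : F) = x₀ at *
  generalize cubicSum p (α : F) = x₁ at *
  generalize cubicSum p ((α : F) ^ 2) = x₂ at *
  obtain ⟨y₀, rfl, hy₀⟩ := eq_pow_mul_of_sum_zero hp hk h1 h2 h3 hT
  obtain ⟨y₁, rfl, hy₁⟩ := eq_pow_mul_of_sum_zero hp hk (x₀ := x₁) (x₁ := x₂)
    (x₂ := (p : ℤ) ^ k * y₀) (T := T) (by linarith) (by linarith) (by linarith) hT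
  obtain ⟨y₂, rfl, hy₂⟩ := eq_pow_mul_of_sum_zero hp hk (x₀ := x₂) (x₁ := (p : ℤ) ^ k * y₀)
    (x₂ := (p : ℤ) ^ k * y₁) (T := T) (by linarith) (by linarith) (by linarith) hT
  have hq0 := pow_ne_zero k hp0
  -- This carries the congruence `1 (mod 3)` from the cubic sums to their cofactors.
  have hq3 : (p : ℤ) ^ k ≡ 1 [ZMOD 3] := by
    have : (p : ℤ) ≡ 1 [ZMOD 3] := by exact_mod_cast (Int.natCast_modEq_iff.2 hp3)
    simpa using this.pow k
  have red : ∀ y : ℤ, (p : ℤ) ^ k * y ≡ 1 [ZMOD 3] → y ≡ 1 [ZMOD 3] := fun y h => by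
    have := (hq3.mul_right y).symm.trans h
    simpa using this
  obtain ⟨s, t, u, v, e1, e2, e3, hperm⟩ := exists_cubic_pair (q := (p : ℤ) ^ k)
    (y₀ := y₀) (y₁ := y₁) (y₂ := y₂)
    (mul_left_cancel₀ hq0 (by linear_combination h1))
    (mul_left_cancel₀ (pow_ne_zero 2 hq0) (by linear_combination h2))
    (red _ m0) (red _ m1) (red _ m2)
  have hs : s ∈ [y₀, y₁, y₂] := hperm.mem_iff.2 (by simp)
  refine ⟨s, t, u, v, e1, ?_, ?_, e2, e3, hperm.map (fun x => (p : ℤ) ^ k * x)⟩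
  · simp only [List.mem_cons, List.not_mem_nil, or_false] at hs
    rcases hs with rfl | rfl | rfl
    exacts [red _ m0, red _ m1, red _ m2]
  · simp only [List.mem_cons, List.not_mem_nil, or_false] at hs
    rcases hs with rfl | rfl | rfl <;> assumption

/-- The shape of the three cubic sums when `p ≡ 2 (mod 3)`. -/
theorem cubicSum_perm_inert (hcube : ScalarsAreCubes p F) {n k : ℕ} (hn : 0 < n)
    (hF : Fintype.card F = n * 3 + 1) (hr : p ^ (2 * k) = n * 3 + 1)
    (hp3 : p ≡ 2 [MOD 3]) {α : Fˣ} (hα : ∀ x : Fˣ, x ∈ Subgroup.zpowers α) {ε : ℤ}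
    (hε : ε = 1 ∨ ε = -1) (hεp : ε * (p : ℤ) ^ k ≡ 1 [ZMOD 3]) :
    [cubicSum p (1 : F), cubicSum p (α : F), cubicSum p ((α : F) ^ 2)].Perm
      [ε * (p : ℤ) ^ k, ε * (p : ℤ) ^ k, -2 * (ε * (p : ℤ) ^ k)] := by
  have hp : p.Prime := Fact.out
  have hcard : (Fintype.card F : ℤ) = (p : ℤ) ^ (2 * k) := by rw [hF, ← hr]; push_cast; rfl
  have h1 := cubicSum_moment_one hcube hn hF hα
  have h2 := cubicSum_moment_two hcube hn hF hα
  have hmem : ∀ S ∈ [cubicSum p (1 : F), cubicSum p (α : F), cubicSum p ((α : F) ^ 2)],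
      S ≡ 1 [ZMOD 3] := by
    intro S hS
    simp only [List.mem_cons, List.not_mem_nil, or_false] at hS
    rcases hS with rfl | rfl | rfl <;> exact cubicSum_modEq_one hcube hn hF hα _
  rw [hcard] at h2
  unfold Int.ModEq at hεp hmem
  -- Of the two sign patterns, only the one agreeing with `ε` is compatible with all cubic sums
  -- being `1 (mod 3)`.
  rcases perm_of_sum_zero_of_inert hp hp3 k _ _ _ h1 h2 with h | h
  · have := hmem _ (h.mem_iff.2 (by simp) : (p : ℤ) ^ k ∈ _)
    rcases hε with rfl | rfl
    · simpa using h
    · omega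
  · have := hmem _ (h.mem_iff.2 (by simp) : -(p : ℤ) ^ k ∈ _)
    rcases hε with rfl | rfl
    · omega
    · simpa using h

end Main

theorem mainTheorem3 (p : ℕ) [Fact p.Prime] (m r n : ℕ) (hm : 0 < m) (hr : r = p ^ m)
    (hN : 3 ∣ (r - 1) / (p - 1)) (hn : r - 1 = n * 3) (hn1 : 1 < n)
    {F : Type*} [Field F] [Fintype F] [Algebra (ZMod p) F] (hF : Fintype.card F = r)
    (α : Fˣ) (hα : ∀ x : Fˣ, x ∈ Subgroup.zpowers α)
    (I : Finset ℕ) (hI : I ⊆ Finset.range 3) (hI1 : I.card = 1) :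
    -- length `n` and dimension `m`
    (definingSet α 3 I).card = n ∧
    Module.finrank (ZMod p) (traceCode p (definingSet α 3 I)) = m ∧
    -- cyclic, for the ordering `α^i, α^(i+3), …, α^(i+3(n-1))` of the coordinates
    (∃ e : Fin n ≃ definingSet α 3 I,
      (∀ i ∈ I, ∀ j : Fin n, (e j : F) = (α : F) ^ (i + 3 * (j : ℕ))) ∧
      IsCyclicCode
        ((traceCode p (definingSet α 3 I)).map (LinearMap.funLeft (ZMod p) (ZMod p) e))) ∧
    -- (a)
    (p ≡ 1 [MOD 3] → m ≡ 0 [MOD 3] →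
      (∃ s t : ℤ, IsCubicPair p r s t) ∧
      ∀ s t : ℤ, IsCubicPair p r s t →
        ∃ a₁ b₁ a₂ b₂ a₃ b₃ : ℕ,
          (a₁ : ℝ) = n / p - (p - 1) / (3 * p) * (1 - s * (r : ℝ) ^ (1 / 3 : ℝ)) ∧
          (b₁ : ℝ) = n / p + 1 / (3 * p) * (1 - s * (r : ℝ) ^ (1 / 3 : ℝ)) ∧
          (a₂ : ℝ) = n / p - (p - 1) / (6 * p) * (2 + (s + 9 * t) * (r : ℝ) ^ (1 / 3 : ℝ)) ∧
          (b₂ : ℝ) = n / p + 1 / (6 * p) * (2 + (s + 9 * t) * (r : ℝ) ^ (1 / 3 : ℝ)) ∧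
          (a₃ : ℝ) = n / p - (p - 1) / (6 * p) * (2 + (s - 9 * t) * (r : ℝ) ^ (1 / 3 : ℝ)) ∧
          (b₃ : ℝ) = n / p + 1 / (6 * p) * (2 + (s - 9 * t) * (r : ℝ) ^ (1 / 3 : ℝ)) ∧
          codeCWE (traceCode p (definingSet α 3 I)) =
            MvPolynomial.X 0 ^ n
              + (n : MvPolynomial (ZMod p) ℤ) * balancedMonomial p a₁ b₁
              + (n : MvPolynomial (ZMod p) ℤ) * balancedMonomial p a₂ b₂
              + (n : MvPolynomial (ZMod p) ℤ) * balancedMonomial p a₃ b₃) ∧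
    -- (b)
    (p ≡ 2 [MOD 3] → m ≡ 0 [MOD 4] →
      ∃ a₁ b₁ a₂ b₂ : ℕ,
        (a₁ : ℝ) = n / p - (p - 1) / (3 * p) * (1 - √(r : ℝ)) ∧
        (b₁ : ℝ) = n / p + 1 / (3 * p) * (1 - √(r : ℝ)) ∧
        (a₂ : ℝ) = n / p - (p - 1) / (3 * p) * (1 + 2 * √(r : ℝ)) ∧
        (b₂ : ℝ) = n / p + 1 / (3 * p) * (1 + 2 * √(r : ℝ)) ∧
        codeCWE (traceCode p (definingSet α 3 I)) =
          MvPolynomial.X 0 ^ n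
            + 2 * (n : MvPolynomial (ZMod p) ℤ) * balancedMonomial p a₁ b₁
            + (n : MvPolynomial (ZMod p) ℤ) * balancedMonomial p a₂ b₂) ∧
    -- (c)
    (p ≡ 2 [MOD 3] → m ≡ 2 [MOD 4] →
      ∃ a₁ b₁ a₂ b₂ : ℕ,
        (a₁ : ℝ) = n / p - (p - 1) / (3 * p) * (1 + √(r : ℝ)) ∧
        (b₁ : ℝ) = n / p + 1 / (3 * p) * (1 + √(r : ℝ)) ∧
        (a₂ : ℝ) = n / p - (p - 1) / (3 * p) * (1 - 2 * √(r : ℝ)) ∧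
        (b₂ : ℝ) = n / p + 1 / (3 * p) * (1 - 2 * √(r : ℝ)) ∧
        codeCWE (traceCode p (definingSet α 3 I)) =
          MvPolynomial.X 0 ^ n
            + 2 * (n : MvPolynomial (ZMod p) ℤ) * balancedMonomial p a₁ b₁
            + (n : MvPolynomial (ZMod p) ℤ) * balancedMonomial p a₂ b₂) := by
  have hp : p.Prime := Fact.out
  have hr1 : p ^ m = n * 3 + 1 := by have := hp.pos; have : 0 < p ^ m := by positivity
                                     omega
  have hF' : Fintype.card F = n * 3 + 1 := by rw [hF, hr, hr1]
  have hn0 : 0 < n := by omega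
  rw [hr] at hN
  have hcube : ScalarsAreCubes p F := scalarsAreCubes hn0 hr1.symm hN hF' hα
  obtain ⟨i, rfl⟩ := Finset.card_eq_one.1 hI1
  rw [definingSet_singleton]
  obtain ⟨e, he⟩ := exists_equiv_cyclotomicClass hn0 hF' hα i
  have hp0 : (p : ℝ) ≠ 0 := by exact_mod_cast hp.ne_zero
  refine ⟨?_, ?_, ⟨e, ?_, traceCode_cyclic hF' hα i e he⟩, ?_, ?_, ?_⟩
  · rw [← Fintype.card_coe, ← Fintype.card_congr e, Fintype.card_fin]
  · rw [traceCode_finrank hcube hn1 hF' hα]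
    have h := Module.card_eq_pow_finrank (K := ZMod p) (V := F)
    rw [hF, hr, ZMod.card] at h
    exact (Nat.pow_right_injective hp.two_le h).symm
  · intro i' hi' j
    rw [Finset.mem_singleton.1 hi']
    exact he j
  · intro hp3 hm3
    obtain ⟨k, rfl⟩ := (Nat.modEq_zero_iff_dvd).1 hm3
    have hk : 0 < k := by omega
    have hroot : (r : ℝ) ^ (1 / 3 : ℝ) = (p : ℝ) ^ k := by
      rw [hr, Nat.cast_pow, mul_comm, pow_mul, ← Real.rpow_natCast, ← Real.rpow_mul (by positivity)]
      norm_num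
    have hp2 : p ≠ 2 := by rintro rfl; exact absurd hp3 (by decide)
    have hp3' : p ≠ 3 := by rintro rfl; exact absurd hp3 (by decide)
    have hpair : ∀ s t : ℤ, IsCubicPair p r s t ↔
        4 * (p : ℤ) ^ k = s ^ 2 + 27 * t ^ 2 ∧ s ≡ 1 [ZMOD 3] ∧ ¬ (p : ℤ) ∣ s := by
      intro s t
      rw [IsCubicPair, hroot, isCoprime_comm,
        (Nat.prime_iff_prime_int.1 hp).irreducible.coprime_iff_not_dvd]
      norm_cast
    obtain ⟨s₀, t₀, u, v, e1, e2, e3, e4, e5, hperm⟩ :=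
      cubicSum_perm_split hcube hn0 hF' hr1 hk hp3 hα
    refine ⟨⟨s₀, t₀, (hpair _ _).2 ⟨e1, e2, e3⟩⟩, fun s t hst => ?_⟩
    obtain ⟨f1, f2, f3⟩ := (hpair _ _).1 hst
    obtain ⟨rfl, ht⟩ := cubic_pair_unique hp hp2 hp3' hk e1 f1 e3 f3 e2 f2
    -- Changing the sign of `t` only interchanges the last two cubic sums, so any admissible pair
    -- works.
    obtain ⟨u', v', g4, g5, hperm'⟩ : ∃ u' v' : ℤ, 2 * u' = -s₀ - 9 * t ∧ 2 * v' = -s₀ + 9 * t ∧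
        [cubicSum p (1 : F), cubicSum p (α : F), cubicSum p ((α : F) ^ 2)].Perm
          [(p : ℤ) ^ k * s₀, (p : ℤ) ^ k * u', (p : ℤ) ^ k * v'] := by
      rcases ht with rfl | rfl
      · exact ⟨u, v, e4, e5, hperm⟩
      · exact ⟨v, u, by linarith, by linarith,
          hperm.trans (List.Perm.cons _ (List.Perm.swap _ _ _))⟩
    obtain ⟨a₁, b₁, a₂, b₂, a₃, b₃, ⟨A1, B1⟩, ⟨A2, B2⟩, ⟨A3, B3⟩, hC⟩ :=
      codeCWE_eq_of_perm hcube hn1 hF' hα i hperm'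
    have hu : (u' : ℝ) = (-s₀ - 9 * t) / 2 := by
      have : (2 : ℝ) * u' = -s₀ - 9 * t := by exact_mod_cast g4
      linarith
    have hv : (v' : ℝ) = (-s₀ + 9 * t) / 2 := by
      have : (2 : ℝ) * v' = -s₀ + 9 * t := by exact_mod_cast g5
      linarith
    push_cast at A1 B1 A2 B2 A3 B3
    rw [hu] at A2 B2
    rw [hv] at A3 B3
    rw [hroot]
    refine ⟨a₁, b₁, a₂, b₂, a₃, b₃, ?_, ?_, ?_, ?_, ?_, ?_, hC⟩
    · rw [A1]; ring
    · rw [B1]; ring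
    · rw [A2]; field_simp; ring
    · rw [B2]; field_simp; ring
    · rw [A3]; field_simp; ring
    · rw [B3]; field_simp; ring
  · intro hp3 hm4
    obtain ⟨l, rfl⟩ := (Nat.modEq_zero_iff_dvd).1 hm4
    have hsqrt : √(r : ℝ) = (p : ℝ) ^ (2 * l) := by
      rw [hr, Nat.cast_pow, show 4 * l = 2 * l * 2 by ring, pow_mul _ _ 2,
        Real.sqrt_sq (by positivity)]
    have hmod : (1 : ℤ) * (p : ℤ) ^ (2 * l) ≡ 1 [ZMOD 3] := by
      have h2 : (p : ℤ) ≡ 2 [ZMOD 3] := by exact_mod_cast (Int.natCast_modEq_iff.2 hp3)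
      have h4 : (p : ℤ) ^ 2 ≡ 1 [ZMOD 3] := (h2.pow 2).trans (by decide)
      rw [one_mul, pow_mul]
      simpa using h4.pow l
    have hperm := cubicSum_perm_inert hcube (k := 2 * l) hn0 hF' (by rw [← hr1]; congr 1; ring)
      hp3 hα (Or.inl rfl) hmod
    obtain ⟨a₁, b₁, a₂, b₂, a₃, b₃, ⟨A1, B1⟩, ⟨A2, B2⟩, ⟨A3, B3⟩, hC⟩ :=
      codeCWE_eq_of_perm hcube hn1 hF' hα i hperm
    have ha : a₂ = a₁ := by exact_mod_cast A2.trans A1.symm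
    have hb : b₂ = b₁ := by exact_mod_cast B2.trans B1.symm
    push_cast at A1 B1 A3 B3
    rw [hsqrt]
    refine ⟨a₁, b₁, a₃, b₃, ?_, ?_, ?_, ?_, ?_⟩
    · rw [A1]; ring
    · rw [B1]; ring
    · rw [A3]; ring
    · rw [B3]; ring
    · rw [hC, ha, hb]; ring
  · intro hp3 hm4
    obtain ⟨l, rfl⟩ : ∃ l, m = 2 * (2 * l + 1) := ⟨m / 4, by unfold Nat.ModEq at hm4; omega⟩
    have hsqrt : √(r : ℝ) = (p : ℝ) ^ (2 * l + 1) := by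
      rw [hr, Nat.cast_pow, mul_comm 2 (2 * l + 1), pow_mul _ _ 2, Real.sqrt_sq (by positivity)]
    -- Here `√r` is an odd power of `p`, hence `-1 (mod 3)`, so the sign is opposite to that in case
    -- (b).
    have hmod : (-1 : ℤ) * (p : ℤ) ^ (2 * l + 1) ≡ 1 [ZMOD 3] := by
      have h2 : (p : ℤ) ≡ 2 [ZMOD 3] := by exact_mod_cast (Int.natCast_modEq_iff.2 hp3)
      have h4 : (p : ℤ) ^ 2 ≡ 1 [ZMOD 3] := (h2.pow 2).trans (by decide)
      have h5 := ((h4.pow l).mul h2).mul_left (-1)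
      rw [pow_succ, pow_mul]
      exact h5.trans (by rw [one_pow]; decide)
    have hperm := cubicSum_perm_inert hcube (k := 2 * l + 1) hn0 hF' hr1 hp3 hα (Or.inr rfl) hmod
    obtain ⟨a₁, b₁, a₂, b₂, a₃, b₃, ⟨A1, B1⟩, ⟨A2, B2⟩, ⟨A3, B3⟩, hC⟩ :=
      codeCWE_eq_of_perm hcube hn1 hF' hα i hperm
    have ha : a₂ = a₁ := by exact_mod_cast A2.trans A1.symm
    have hb : b₂ = b₁ := by exact_mod_cast B2.trans B1.symm
    push_cast at A1 B1 A3 B3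
    rw [hsqrt]
    refine ⟨a₁, b₁, a₃, b₃, ?_, ?_, ?_, ?_, ?_⟩
    · rw [A1]; ring
    · rw [B1]; ring
    · rw [A3]; ring
    · rw [B3]; ring
    · rw [hC, ha, hb]; ring
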